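/- **Setting.** Let $f(x)=\sum_{e=1}^r c_e\|x(S_e)\|_{q_e}$ for $x\in\mathbb R^n_{\ge 0}$, where $S_e\subseteq[n]$ (the sets may overlap), $q_e\ge 1$, $c_e\ge 0$, and $\|x(S)\|_q=(\sum_{k\in S}x_k^q)^{1/q}$. Let $x'\in\mathbb R^n_{\ge 0}$ (the advice), $\lambda\in[0,1]$ (the confidence parameter) and an integer $d\ge1$ be given in advance. The rows $A_1,A_2,\dots$ of a matrix $A$ with entries $a_{tj}\ge 0$ and no zero row arrive one at a time. On the arrival of $A_t$ an online algorithm, knowing only $f,x',\lambda,d$ and the rows so far, must increase its solution $x\in\mathbb R^n_{\ge 0}$ coordinatewise (never decreasing a coordinate) so that $A_t x\ge 1$. **Algorithm.** Start with $x=0$. In round $t$, if $A_tx\ge 1$, do nothing. Otherwise, until $A_t x\ge 1$, continuously increase every $x_j$ with $a_{tj}>0$ at rate $$\frac{\partial x_j}{\partial\tau}=\frac{a_{tj}}{\nabla_j f(x)}\bigl(x_j+D_j\bigr),$$ where, at the current $x$, $D_j=\frac1{a_{tj}d}$ if $A_tx'<1$, and $$D_j=\frac{\lambda}{a_{tj}d}+\frac{(1-\lambda)\,x'_j\mathbf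 1_{x_j<x'_j}}{A_tx'_c}\quad\text{if }A_tx'\ge1,\qquad (x'_c)_k=x'_k\mathbf 1_{x_k<x'_k}.$$ More precisely, $x$ is a continuous nondecreasing function of $\tau$ that satisfies this rate equation, multiplied by $\nabla_jf(x)$, at all but finitely many times; and if row $t$ has a positive entry in a column $j$ on which $f$ does not depend (so that $\nabla_j f\equiv 0$ and the rate is infinite), then only such coordinates are raised, instantaneously, until $A_tx=1$. **Theorem.** This algorithm can always be carried out, so that it is an online algorithm for the covering problem $\min f(x)$ over $x\ge 0$ with $Ax\ge\mathbf 1$. There is a universal constant $C>0$ such that for all $n,r,f,x',\lambda,d$ as above, for every way of carrying it out, and for every finite sequence of rows with matrix $A$ such that $$d=\max\Bigl\{\max_i|\{j: a_{ij}>0\}|,\ \max_e|S_e|\Bigr\},$$ its final solution $\bar x$ satisfies $$f(\bar x)\le\min\Bigl\{\tfrac{C}{1-\lambda}f(x')+C\,(1+\log(\kappa d))\,\mathsf{OPT},\ \ C\,\bigl(1+\log\tfrac{\kappa d}{\lambda}\bigr)\,\mathsf{OPT}\Bigr\},$$ where the first bound is claimed for $\lambda<1$ and the second for $\lambda>0$.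 If moreover $\lambda<1$ and $Ax'\ge\mathbf 1$, then $f(\bar x)\le\frac{C}{1-\lambda}f(x')$. Here $\mathsf{OPT}=\inf\{f(x):x\ge0,\ Ax\ge\mathbf 1\}$ and $\kappa=a_{\max}/a_{\min}$ is the ratio of the largest to the smallest positive entry of $A$. -/

import Mathlib

open scoped Matrix

/-- Data of an objective `f(x) = ∑ e, c e * ‖x(S e)‖_{q e}` with `r` terms in `n` variables.
The index sets may overlap, be empty, and need not cover all the variables. -/
structure LqObjective (n r : ℕ) where
  S : Fin r → Finset (Fin n)
  q : Fin r → ℝ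
  c : Fin r → ℝ
  one_le_q : ∀ e, 1 ≤ q e
  c_nonneg : ∀ e, 0 ≤ c e

namespace LqObjective

variable {n r : ℕ}

/-- The objective `f` on the nonnegative orthant. -/
noncomputable def val (P : LqObjective n r) (x : Fin n → ℝ) : ℝ :=
  ∑ e, P.c e * (∑ k ∈ P.S e, x k ^ P.q e) ^ (1 / P.q e)

/-- The partial derivative `∇_j f(x)` of the objective. It is used along trajectories only outside
finitely many times; for `q e = 1` the summand is the constant `c e`. -/
noncomputable def grad (P : LqObjective n r) (x : Fin n → ℝ) (j : Fin n) : ℝ :=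
  ∑ e with j ∈ P.S e,
    P.c e * x j ^ (P.q e - 1) * (∑ k ∈ P.S e, x k ^ P.q e) ^ (1 / P.q e - 1)

/-- The objective does not depend on the variable `x j`, that is, `∇_j f` vanishes identically. -/
def IsFree (P : LqObjective n r) (j : Fin n) : Prop :=
  ∀ e, j ∈ P.S e → P.c e = 0

/-- `d`: the maximum of the row sparsity of `A` and of the largest `|S e|`. -/
noncomputable def dim (P : LqObjective n r) {m : ℕ} (A : Matrix (Fin m) (Fin n) ℝ) : ℕ :=
  max (Finset.univ.sup fun i => Set.ncard {j | 0 < A i j})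
    (Finset.univ.sup fun e => (P.S e).card)

/-- `OPT`: the infimum of the objective over all `x ≥ 0` with `A x ≥ 1`. -/
noncomputable def opt (P : LqObjective n r) {m : ℕ} (A : Matrix (Fin m) (Fin n) ℝ) : ℝ :=
  sInf (P.val '' {x | (∀ j, 0 ≤ x j) ∧ ∀ i, 1 ≤ (A *ᵥ x) i})

end LqObjective

/-- `κ = a_max / a_min`, the largest over the smallest positive entry of `A`. -/
noncomputable def condNumber {m n : ℕ} (A : Matrix (Fin m) (Fin n) ℝ) : ℝ :=
  sSup {a | 0 < a ∧ ∃ i j, A i j = a} / sInf {a | 0 < a ∧ ∃ i j, A i j = a}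

/-- A row of a (satisfiable) covering constraint `a · x ≥ 1`: nonnegative and not zero. -/
def IsCoveringRow {n : ℕ} (a : Fin n → ℝ) : Prop :=
  (∀ j, 0 ≤ a j) ∧ ∃ j, 0 < a j

/-- A deterministic online covering algorithm in `n` variables: its solution is a function of the
rows that have arrived so far, in order of arrival; it is never decreased, and after each arrival it
satisfies the newly arrived constraint. -/
structure OnlineCoveringAlgorithm (n : ℕ) where
  output : List (Fin n → ℝ) → Fin n → ℝ
  nonneg_nil : ∀ j, 0 ≤ output [] j
  mono : ∀ h : List (Fin n → ℝ), (∀ b ∈ h, IsCoveringRow b) → ∀ a, IsCoveringRow a →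
    ∀ j, output h j ≤ output (h ++ [a]) j
  covers : ∀ h : List (Fin n → ℝ), (∀ b ∈ h, IsCoveringRow b) → ∀ a, IsCoveringRow a →
    1 ≤ a ⬝ᵥ output (h ++ [a])

namespace LqCover

variable {n r : ℕ}

/-- `x'_c`: the advice restricted to the entries that the current solution `x` has not reached. -/
noncomputable def remainingAdvice (x' x : Fin n → ℝ) (k : Fin n) : ℝ :=
  if x k < x' k then x' k else 0

/-- The additive term `D_j` in the growth rate, for the arriving row `a` and current solution `x`
(it is re-evaluated as `x` grows). -/
noncomputable def additiveTerm (d : ℕ) (lam : ℝ) (x' a x : Fin n → ℝ) (j : Fin n) : ℝ :=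
  if 1 ≤ a ⬝ᵥ x' then
    lam / (a j * d) + (1 - lam) * remainingAdvice x' x j / (a ⬝ᵥ remainingAdvice x' x)
  else 1 / (a j * d)

/-- `u : [0, T] → ℝⁿ` is an execution of the continuous while-loop for the arriving row `a`,
started in `x` and ended in `z`: while `a · u < 1`, every `u_j` with `a_j > 0` increases at rate
`a_j / ∇_j f(u) * (u_j + D_j)` and the other coordinates stay put. The rate equation is multiplied
by `∇_j f(u)` (which may be `0` when `u_j = 0`, where the rate is infinite), and it holds
at all but finitely many times. The duration `T` is the value given to the dual variable of the
row. -/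
structure IsLoop (P : LqObjective n r) (d : ℕ) (lam : ℝ) (x' a x z : Fin n → ℝ)
    (T : ℝ) (u : ℝ → Fin n → ℝ) : Prop where
  duration_nonneg : 0 ≤ T
  start : u 0 = x
  finish : u T = z
  continuousOn : ContinuousOn u (Set.Icc 0 T)
  monotoneOn : MonotoneOn u (Set.Icc 0 T)
  unsatisfied : ∀ τ ∈ Set.Ico 0 T, a ⬝ᵥ u τ < 1
  satisfied : 1 ≤ a ⬝ᵥ z
  inactive : ∀ τ ∈ Set.Icc 0 T, ∀ j, a j = 0 → u τ j = x j
  rate : ∃ E : Set ℝ, E.Finite ∧ ∀ τ ∈ Set.Ioo 0 T \ E, ∀ j, 0 < a j →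
    ∃ v : ℝ, HasDerivAt (fun s => u s j) v τ ∧
      P.grad (u τ) j * v = a j * (u τ j + additiveTerm d lam x' a (u τ) j)

/-- One round of the algorithm, turning the solution `x` into `z` on arrival of the row `a`.
If the constraint holds already, nothing happens. If it involves a variable on which the objective
does not depend (infinite rate), such variables are raised instantaneously until the constraint
holds. Otherwise the continuous loop is executed. -/
def IsRound (P : LqObjective n r) (d : ℕ) (lam : ℝ) (x' a x z : Fin n → ℝ) : Prop :=
  (1 ≤ a ⬝ᵥ x ∧ z = x) ∨
  (a ⬝ᵥ x < 1 ∧ (∃ j, 0 < a j ∧ P.IsFree j) ∧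
    (∀ j, x j ≤ z j) ∧ (∀ j, ¬ (0 < a j ∧ P.IsFree j) → z j = x j) ∧ a ⬝ᵥ z = 1) ∨
  (a ⬝ᵥ x < 1 ∧ (∀ j, 0 < a j → ¬ P.IsFree j) ∧ ∃ T u, IsLoop P d lam x' a x z T u)

/-- The online algorithm `alg` is the primal-dual learning-augmented algorithm for the objective
`P`, sparsity parameter `d`, confidence `lam` and advice `x'`: it starts from `0` and in every round
performs `IsRound`. -/
def Implements (alg : OnlineCoveringAlgorithm n) (P : LqObjective n r) (d : ℕ) (lam : ℝ)
    (x' : Fin n → ℝ) : Prop :=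
  (∀ j, alg.output [] j = 0) ∧
  ∀ h : List (Fin n → ℝ), (∀ b ∈ h, IsCoveringRow b) → ∀ a, IsCoveringRow a →
    IsRound P d lam x' a (alg.output h) (alg.output (h ++ [a]))

end LqCover

/-! The competitive bounds come from two potentials that pay for the growth of `f`. While the row
`a` is unsatisfied, `f` grows at rate `∑ a_j (u_j + D_j) ≤ 1 + 1`, so any monotone potential growing
at rate at least `ρ` pays for the loop with factor `2 / ρ`. Rounds that raise free coordinates cost
nothing.

The advice potential is `f (min u x')`. Truncation leaves an unreached coordinate unchanged and only
shrinks the norms, whose exponent `1/q - 1` in the gradient is nonpositive; so the gradient at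
unreached coordinates only increases. For a row that the advice satisfies the rate is therefore at
least `1 - λ`, and the potential never exceeds `f x'` (`val_sub_le_advice`).

The logarithmic potential has a feasible reference point `w` and an offset `δ` below all the `D_j`.
It combines `‖w‖ log (‖u‖ + δ)` with the sum of `w_k ∂_k‖w‖ log (u_k + δ)`. By `termGrad_mul_div_le`
its rate is at least `∑ ∇_k f(u) u_k' w_k / (u_k + δ) ≥ a · w ≥ 1`. All coordinates stay below `1 /
a_min`, so its total growth is at most `f w` times a logarithm. With `δ = 1 / (a_max d)` it handles
the rows that the advice violates; with `δ = λ / (a_max d)` it handles every row. The first bound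
adds both potentials, and each of the other two bounds uses one of them.

For existence, the difficulty is that the rates are singular where coordinates vanish. With `D`
frozen, the equation is solved from perturbed positive starting points by Picard–Lindelöf. The
solutions obey two-sided difference inequalities (`IsFlow`) that survive pointwise limits, and from
which the differential equation is recovered by squeezing slopes. A coordinate with positive `D_j`
leaves zero at once; one with `u_j = D_j = 0` may stay there. Since `D` changes only when an active
coordinate reaches its advice, finitely many phases are concatenated. -/

open Set Filter Topology

/-! ### Monotonicity from one-sided derivatives -/

/-- A continuous function whose right derivative is nonnegative outside a finite set increases. -/
theorem le_of_rightDeriv_nonneg_off_finite {E : Set ℝ} (hE : E.Finite) {g : ℝ → ℝ} {a b : ℝ}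
    (hab : a ≤ b) (hg : ContinuousOn g (Icc a b))
    (hd : ∀ t ∈ Ioo a b \ E, ∃ v, 0 ≤ v ∧ HasDerivWithinAt g v (Ici t) t) : g a ≤ g b := by
  induction E, hE using Set.Finite.induction_on generalizing a b with
  | empty =>
    rcases hab.eq_or_lt with rfl | hlt
    · exact le_rfl
    -- Nothing is known about the derivative at `a`, so the comparison starts at an interior `s`,
    -- which then tends to `a`.
    have key : ∀ s ∈ Ioo a b, g s ≤ g b := by
      intro s hs
      have hsub : Icc s b ⊆ Icc a b := Icc_subset_Icc_left hs.1.le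
      have hd' : ∀ t, ∃ v, t ∈ Ico s b → 0 ≤ v ∧ HasDerivWithinAt g v (Ici t) t := by
        intro t
        by_cases ht : t ∈ Ico s b
        · obtain ⟨v, hv⟩ := hd t ⟨⟨hs.1.trans_le ht.1, ht.2⟩, by simp⟩
          exact ⟨v, fun _ => hv⟩
        · exact ⟨0, fun h => absurd h ht⟩
      choose g' hg' using hd'
      exact image_le_of_deriv_right_le_deriv_boundary (f := fun _ => g s) (f' := fun _ => 0)
        continuousOn_const (fun t _ => hasDerivWithinAt_const _ _ _) le_rfl (hg.mono hsub)
        (fun t ht => (hg' t ht).2) (fun t ht => (hg' t ht).1) (right_mem_Icc.2 hs.2.le)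
    have ht : Tendsto g (𝓝[Ioo a b] a) (𝓝 (g a)) :=
      (hg a (left_mem_Icc.2 hab)).mono_left (nhdsWithin_mono _ Ioo_subset_Icc_self)
    have : (𝓝[Ioo a b] a).NeBot := left_nhdsWithin_Ioo_neBot hlt
    exact le_of_tendsto ht (eventually_mem_nhdsWithin.mono key)
  | @insert p E' _ _ ih =>
    by_cases hp : p ∈ Ioo a b
    · refine (ih hp.1.le (hg.mono (Icc_subset_Icc_right hp.2.le)) ?_).trans
        (ih hp.2.le (hg.mono (Icc_subset_Icc_left hp.1.le)) ?_)
      · rintro t ⟨ht, htE⟩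
        exact hd t ⟨⟨ht.1, ht.2.trans hp.2⟩, by
          simp only [mem_insert_iff, not_or]; exact ⟨ht.2.ne, htE⟩⟩
      · rintro t ⟨ht, htE⟩
        exact hd t ⟨⟨hp.1.trans ht.1, ht.2⟩, by
          simp only [mem_insert_iff, not_or]; exact ⟨ht.1.ne', htE⟩⟩
    · refine ih hab hg ?_
      rintro t ⟨ht, htE⟩
      refine hd t ⟨ht, ?_⟩
      simp only [mem_insert_iff, not_or]
      exact ⟨fun h => hp (h ▸ ht), htE⟩

/-! ### The norms, their gradients and the chain rule -/

namespace LqObjective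

variable {n r : ℕ} (P : LqObjective n r)

/-- The sum of `q e`-th powers over `S e`. -/
noncomputable def powSum (e : Fin r) (x : Fin n → ℝ) : ℝ := ∑ k ∈ P.S e, x k ^ P.q e

/-- The `q e`-norm of the restriction to `S e`. -/
noncomputable def termNorm (e : Fin r) (x : Fin n → ℝ) : ℝ := P.powSum e x ^ (1 / P.q e)

/-- The partial derivative of `termNorm e`. -/
noncomputable def termGrad (e : Fin r) (x : Fin n → ℝ) (k : Fin n) : ℝ :=
  x k ^ (P.q e - 1) * P.powSum e x ^ (1 / P.q e - 1)

theorem val_eq (x : Fin n → ℝ) : P.val x = ∑ e, P.c e * P.termNorm e x := rfl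

theorem grad_eq (x : Fin n → ℝ) (j : Fin n) :
    P.grad x j = ∑ e with j ∈ P.S e, P.c e * P.termGrad e x j := by
  simp only [grad, termGrad, powSum, mul_assoc]

theorem q_pos (e : Fin r) : 0 < P.q e := zero_lt_one.trans_le (P.one_le_q e)

theorem one_div_q_sub_one_nonpos (e : Fin r) : 1 / P.q e - 1 ≤ 0 := by
  have := (div_le_one (P.q_pos e)).2 (P.one_le_q e)
  linarith

variable {P} {x y w u v : Fin n → ℝ} {e : Fin r} {k : Fin n}

theorem powSum_nonneg (hx : ∀ k, 0 ≤ x k) : 0 ≤ P.powSum e x :=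
  Finset.sum_nonneg fun k _ => Real.rpow_nonneg (hx k) _

theorem powSum_mono (hx : ∀ k, 0 ≤ x k) (hxy : ∀ k, x k ≤ y k) : P.powSum e x ≤ P.powSum e y :=
  Finset.sum_le_sum fun k _ => Real.rpow_le_rpow (hx k) (hxy k) (P.q_pos e).le

theorem rpow_le_powSum (hx : ∀ k, 0 ≤ x k) (hk : k ∈ P.S e) : x k ^ P.q e ≤ P.powSum e x :=
  Finset.single_le_sum (f := fun k => x k ^ P.q e) (fun k _ => Real.rpow_nonneg (hx k) _) hk

theorem powSum_pos (hx : ∀ k, 0 ≤ x k) (hk : k ∈ P.S e) (hpos : 0 < x k) : 0 < P.powSum e x :=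
  (Real.rpow_pos_of_pos hpos _).trans_le (rpow_le_powSum hx hk)

theorem termNorm_nonneg (hx : ∀ k, 0 ≤ x k) : 0 ≤ P.termNorm e x :=
  Real.rpow_nonneg (powSum_nonneg hx) _

theorem termNorm_mono (hx : ∀ k, 0 ≤ x k) (hxy : ∀ k, x k ≤ y k) :
    P.termNorm e x ≤ P.termNorm e y :=
  Real.rpow_le_rpow (powSum_nonneg hx) (powSum_mono hx hxy) (one_div_nonneg.2 (P.q_pos e).le)

theorem termNorm_rpow (hx : ∀ k, 0 ≤ x k) : P.termNorm e x ^ P.q e = P.powSum e x := by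
  rw [termNorm, ← Real.rpow_mul (powSum_nonneg hx), one_div_mul_cancel (P.q_pos e).ne',
    Real.rpow_one]

theorem le_termNorm (hx : ∀ k, 0 ≤ x k) (hk : k ∈ P.S e) : x k ≤ P.termNorm e x := by
  rw [← Real.rpow_le_rpow_iff (hx k) (termNorm_nonneg hx) (P.q_pos e), termNorm_rpow hx]
  exact rpow_le_powSum hx hk

theorem val_nonneg (hx : ∀ k, 0 ≤ x k) : 0 ≤ P.val x :=
  Finset.sum_nonneg fun e _ => mul_nonneg (P.c_nonneg e) (termNorm_nonneg hx)

theorem val_mono (hx : ∀ k, 0 ≤ x k) (hxy : ∀ k, x k ≤ y k) : P.val x ≤ P.val y :=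
  Finset.sum_le_sum fun e _ => mul_le_mul_of_nonneg_left (termNorm_mono hx hxy) (P.c_nonneg e)

theorem termNorm_zero : P.termNorm e (fun _ => 0) = 0 := by
  have h : P.powSum e (fun _ => 0) = 0 := by
    simp [powSum, Real.zero_rpow (P.q_pos e).ne']
  rw [termNorm, h, Real.zero_rpow (one_div_pos.2 (P.q_pos e)).ne']

theorem val_zero : P.val (fun _ => 0) = 0 := by
  simp [val_eq, termNorm_zero]

/-- The factor `d` is cruder than `d ^ (1 / q)` but uniform in `q ≥ 1`; inside a logarithm the loss
is a constant factor. -/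
theorem termNorm_le_card_mul {d : ℕ} {M : ℝ} (hd : 1 ≤ d) (hM : 0 ≤ M) (hx : ∀ k, 0 ≤ x k)
    (hxM : ∀ k, x k ≤ M) (hcard : (P.S e).card ≤ d) : P.termNorm e x ≤ d * M := by
  have hd' : (1 : ℝ) ≤ d := by exact_mod_cast hd
  rw [← Real.rpow_le_rpow_iff (termNorm_nonneg hx) (by positivity) (P.q_pos e), termNorm_rpow hx]
  calc P.powSum e x ≤ ∑ k ∈ P.S e, M ^ P.q e :=
        Finset.sum_le_sum fun k _ => Real.rpow_le_rpow (hx k) (hxM k) (P.q_pos e).le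
    _ = (P.S e).card * M ^ P.q e := by simp
    _ ≤ (d : ℝ) ^ P.q e * M ^ P.q e := by
        gcongr
        calc ((P.S e).card : ℝ) ≤ d := by exact_mod_cast hcard
          _ = (d : ℝ) ^ (1 : ℝ) := (Real.rpow_one _).symm
          _ ≤ (d : ℝ) ^ P.q e := Real.rpow_le_rpow_of_exponent_le hd' (P.one_le_q e)
    _ = (d * M) ^ P.q e := (Real.mul_rpow (by positivity) hM).symm

theorem termGrad_nonneg (hx : ∀ k, 0 ≤ x k) : 0 ≤ P.termGrad e x k :=
  mul_nonneg (Real.rpow_nonneg (hx k) _) (Real.rpow_nonneg (powSum_nonneg hx) _)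

theorem grad_nonneg (hx : ∀ k, 0 ≤ x k) : 0 ≤ P.grad x k := by
  rw [grad_eq]
  exact Finset.sum_nonneg fun e _ => mul_nonneg (P.c_nonneg e) (termGrad_nonneg hx)

theorem powSum_rpow_eq (hx : ∀ k, 0 ≤ x k) :
    P.powSum e x ^ (1 / P.q e - 1) = P.termNorm e x ^ (1 - P.q e) := by
  rw [termNorm, ← Real.rpow_mul (powSum_nonneg hx)]
  congr 1
  have := (P.q_pos e).ne'
  field_simp

theorem termGrad_eq_div (hx : ∀ k, 0 ≤ x k) (hs : 0 < P.termNorm e x) :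
    P.termGrad e x k = (x k / P.termNorm e x) ^ (P.q e - 1) := by
  rw [termGrad, powSum_rpow_eq hx, Real.div_rpow (hx k) hs.le, div_eq_mul_inv,
    ← Real.rpow_neg hs.le, neg_sub]

theorem sum_grad_mul (h : Fin n → ℝ) :
    ∑ k, P.grad x k * h k = ∑ e, P.c e * ∑ k ∈ P.S e, P.termGrad e x k * h k := by
  simp only [grad_eq, Finset.sum_mul, Finset.mul_sum, Finset.sum_filter]
  rw [Finset.sum_comm]
  refine Finset.sum_congr rfl fun e _ => ?_
  rw [← Finset.sum_filter_add_sum_filter_not Finset.univ (fun k => k ∈ P.S e)]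
  have h0 : ∑ k with k ∉ P.S e, (if k ∈ P.S e then P.c e * P.termGrad e x k * h k else 0) = 0 :=
    Finset.sum_eq_zero fun k hk => if_neg (Finset.mem_filter.1 hk).2
  have h1 : Finset.univ.filter (fun k => k ∈ P.S e) = P.S e := by ext; simp
  simp only [ite_mul, zero_mul]
  rw [h0, add_zero, h1]
  exact Finset.sum_congr rfl fun k hk => by rw [if_pos hk, mul_assoc]

/-- Chain rule for `termNorm e` along a path, also at points where the norm vanishes. -/
theorem hasDerivWithinAt_termNorm {m : ℝ → Fin n → ℝ} {t : ℝ} (h0 : ∀ k, 0 ≤ m t k)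
    (hv : ∀ k ∈ P.S e, HasDerivWithinAt (fun s => m s k) (v k) (Ici t) t)
    (hz : ∀ k ∈ P.S e, m t k = 0 → v k = 0) :
    HasDerivWithinAt (fun s => P.termNorm e (m s)) (∑ k ∈ P.S e, P.termGrad e (m t) k * v k)
      (Ici t) t := by
  have hsum : HasDerivWithinAt (fun s => P.powSum e (m s))
      (∑ k ∈ P.S e, v k * P.q e * m t k ^ (P.q e - 1)) (Ici t) t := by
    unfold powSum
    exact HasDerivWithinAt.fun_sum fun k hk => (hv k hk).rpow_const (Or.inr (P.one_le_q e))
  rcases (powSum_nonneg (P := P) (e := e) h0).eq_or_lt with hQ | hQ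
  · have hmk : ∀ k ∈ P.S e, m t k = 0 := by
      intro k hk
      by_contra hne
      exact (powSum_pos (P := P) h0 hk ((h0 k).lt_of_ne' hne)).ne hQ
    have hT : P.termNorm e (m t) = 0 := by
      rw [termNorm, ← hQ, Real.zero_rpow (one_div_pos.2 (P.q_pos e)).ne']
    have hv0 : ∑ k ∈ P.S e, P.termGrad e (m t) k * v k = 0 :=
      Finset.sum_eq_zero fun k hk => by rw [hz k hk (hmk k hk), mul_zero]
    have hpos : 0 ≤ᶠ[𝓝[Ici t] t] fun s => s - t :=
      eventually_mem_nhdsWithin.mono fun s hs => sub_nonneg.2 hs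
    rw [hv0, hasDerivWithinAt_iff_isLittleO]
    simp only [hT, sub_zero, smul_zero]
    -- Where the norm vanishes, every coordinate in `S e` is zero with zero velocity, hence `o(s -
    -- t)`. The sum of `q`-th powers is then `o((s - t)^q)`, and the root restores `o(s - t)`; the
    -- powers need `s ≥ t`.
    have h1 : (fun s => P.powSum e (m s)) =o[𝓝[Ici t] t] fun s => (s - t) ^ P.q e := by
      unfold powSum
      refine Asymptotics.IsLittleO.fun_sum fun k hk => ?_
      refine Asymptotics.IsLittleO.rpow (P.q_pos e) hpos ?_
      have := hasDerivWithinAt_iff_isLittleO.1 (hv k hk)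
      simpa [hz k hk (hmk k hk), hmk k hk] using this
    have h2 := h1.rpow (r := 1 / P.q e) (one_div_pos.2 (P.q_pos e))
      (hpos.mono fun s hs => Real.rpow_nonneg hs _)
    refine h2.congr' (Eventually.of_forall fun s => rfl) (hpos.mono fun s hs => ?_)
    simp only
    rw [← Real.rpow_mul hs, mul_one_div_cancel (P.q_pos e).ne', Real.rpow_one]
  · have := hsum.rpow_const (p := 1 / P.q e) (Or.inl hQ.ne')
    refine this.congr_deriv ?_
    rw [Finset.sum_mul, Finset.sum_mul]
    refine Finset.sum_congr rfl fun k _ => ?_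
    rw [termGrad]
    have := (P.q_pos e).ne'
    field_simp

theorem hasDerivWithinAt_val {m : ℝ → Fin n → ℝ} {t : ℝ} (h0 : ∀ k, 0 ≤ m t k)
    (hv : ∀ k, HasDerivWithinAt (fun s => m s k) (v k) (Ici t) t)
    (hz : ∀ k, m t k = 0 → v k = 0) :
    HasDerivWithinAt (fun s => P.val (m s)) (∑ k, P.grad (m t) k * v k) (Ici t) t := by
  rw [sum_grad_mul]
  unfold val
  exact HasDerivWithinAt.fun_sum fun e _ =>
    (hasDerivWithinAt_termNorm h0 (fun k _ => hv k) (fun k _ => hz k)).const_mul _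

theorem continuous_termNorm : Continuous (P.termNorm e) := by
  unfold termNorm powSum
  exact (continuous_finsetSum _ fun k _ => (continuous_apply k).rpow_const fun _ =>
    Or.inr (P.q_pos e).le).rpow_const fun _ => Or.inr (one_div_pos.2 (P.q_pos e)).le

theorem continuous_val : Continuous P.val := by
  unfold val
  exact continuous_finsetSum _ fun e _ => continuous_const.mul continuous_termNorm

/-! ### The logarithmic potential -/

/-- The weight of the coordinate `k` in the logarithmic potential. -/
noncomputable def logWeight (P : LqObjective n r) (e : Fin r) (w : Fin n → ℝ) (k : Fin n) : ℝ :=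
  w k * (w k / P.termNorm e w) ^ (P.q e - 1)

/-- The logarithmic potential with reference point `w` and offset `δ`. -/
noncomputable def logPotential (P : LqObjective n r) (δ : ℝ) (w u : Fin n → ℝ) : ℝ :=
  ∑ e, P.c e * (P.termNorm e w * Real.log (P.termNorm e u + δ) +
    ∑ k ∈ P.S e, P.logWeight e w k * Real.log (u k + δ))

theorem logWeight_nonneg (hw : ∀ k, 0 ≤ w k) : 0 ≤ P.logWeight e w k :=
  mul_nonneg (hw k) (Real.rpow_nonneg (div_nonneg (hw k) (termNorm_nonneg hw)) _)

/-- Euler's identity for a function homogeneous of degree one: the weight of `k` is `w_k ∂_k‖w‖`.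
Hence both logarithmic parts of the potential have total weight `‖w‖`. -/
theorem sum_logWeight (hw : ∀ k, 0 ≤ w k) :
    ∑ k ∈ P.S e, P.logWeight e w k = P.termNorm e w := by
  rcases (termNorm_nonneg (P := P) (e := e) hw).eq_or_lt with h | h
  · rw [← h]
    refine Finset.sum_eq_zero fun k hk => ?_
    have : w k = 0 := le_antisymm (h ▸ le_termNorm hw hk) (hw k)
    rw [logWeight, this, zero_mul]
  · have h1 : ∀ k, P.logWeight e w k = w k ^ P.q e * P.termNorm e w ^ (1 - P.q e) := by
      intro k
      rw [logWeight, Real.div_rpow (hw k) h.le, div_eq_mul_inv, ← Real.rpow_neg h.le, neg_sub,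
        ← mul_assoc]
      congr 1
      rcases (hw k).eq_or_lt with h' | h'
      · rw [← h', zero_mul, Real.zero_rpow (P.q_pos e).ne']
      · rw [mul_comm, ← Real.rpow_add_one h'.ne', sub_add_cancel]
    simp only [h1]
    rw [← Finset.sum_mul]
    change P.powSum e w * _ = _
    rw [← termNorm_rpow hw, ← Real.rpow_add h, add_sub_cancel, Real.rpow_one]

/-- If `w_k / (u_k + δ) ≤ ‖w‖ / (‖u‖ + δ)`, the first summand suffices. Otherwise `w_k ≤ ‖w‖` allows
the offsets to be dropped, so `u_k / ‖u‖ < w_k / ‖w‖`; raising to the power `q - 1` bounds the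
gradient at `u` by the one at `w`, and the second summand suffices. -/
theorem termGrad_mul_div_le {δ : ℝ} (hδ : 0 < δ) (hu : ∀ k, 0 ≤ u k) (hw : ∀ k, 0 ≤ w k)
    (hk : k ∈ P.S e) :
    P.termGrad e u k * (w k / (u k + δ)) ≤
      P.termNorm e w * (P.termGrad e u k / (P.termNorm e u + δ)) +
        P.logWeight e w k / (u k + δ) := by
  have hg : 0 ≤ P.termGrad e u k := termGrad_nonneg hu
  have hs : 0 ≤ P.termNorm e u := termNorm_nonneg hu
  have hW : 0 ≤ P.termNorm e w := termNorm_nonneg hw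
  have hl : 0 ≤ P.logWeight e w k := logWeight_nonneg hw
  have huk := hu k
  have hwk := hw k
  have hwW : w k ≤ P.termNorm e w := le_termNorm hw hk
  by_cases hc : w k * (P.termNorm e u + δ) ≤ P.termNorm e w * (u k + δ)
  · have h1 : w k / (u k + δ) ≤ P.termNorm e w / (P.termNorm e u + δ) := by
      rw [div_le_div_iff₀ (by positivity) (by positivity)]
      exact hc
    calc P.termGrad e u k * (w k / (u k + δ))
        ≤ P.termGrad e u k * (P.termNorm e w / (P.termNorm e u + δ)) := by gcongr
      _ = P.termNorm e w * (P.termGrad e u k / (P.termNorm e u + δ)) := by ring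
      _ ≤ _ := le_add_of_nonneg_right (by positivity)
  · push Not at hc
    have h1 : P.termNorm e w * u k < w k * P.termNorm e u := by nlinarith
    have hs' : 0 < P.termNorm e u := by
      by_contra h
      have : P.termNorm e u = 0 := le_antisymm (not_lt.1 h) hs
      rw [this, mul_zero] at h1
      exact absurd h1 (not_lt.2 (by positivity))
    have hw' : 0 < w k := by
      by_contra h
      have : w k = 0 := le_antisymm (not_lt.1 h) hwk
      rw [this, zero_mul] at h1
      exact absurd h1 (not_lt.2 (by positivity))
    have hW' : 0 < P.termNorm e w := hw'.trans_le hwW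
    have h2 : P.termGrad e u k ≤ (w k / P.termNorm e w) ^ (P.q e - 1) := by
      rw [termGrad_eq_div hu hs']
      refine Real.rpow_le_rpow (by positivity) ?_ (sub_nonneg.2 (P.one_le_q e))
      rw [div_le_div_iff₀ hs' hW']
      linarith
    calc P.termGrad e u k * (w k / (u k + δ))
        ≤ (w k / P.termNorm e w) ^ (P.q e - 1) * (w k / (u k + δ)) := by gcongr
      _ = P.logWeight e w k / (u k + δ) := by rw [logWeight]; ring
      _ ≤ _ := le_add_of_nonneg_left (by positivity)

/-- The pointwise inequality `termGrad_mul_div_le`, multiplied by `v_k` and summed; the two summands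
on its right are exactly the derivatives of the two kinds of logarithm. -/
theorem exists_hasDerivWithinAt_logPotential {δ : ℝ} (hδ : 0 < δ) (hw : ∀ k, 0 ≤ w k)
    {m : ℝ → Fin n → ℝ} {t : ℝ} (h0 : ∀ k, 0 ≤ m t k) (hv0 : ∀ k, 0 ≤ v k)
    (hv : ∀ k, HasDerivWithinAt (fun s => m s k) (v k) (Ici t) t)
    (hz : ∀ k, m t k = 0 → v k = 0) :
    ∃ D, ∑ k, P.grad (m t) k * (v k * (w k / (m t k + δ))) ≤ D ∧
      HasDerivWithinAt (fun s => P.logPotential δ w (m s)) D (Ici t) t := by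
  have hT : ∀ e, 0 < P.termNorm e (m t) + δ := fun e =>
    add_pos_of_nonneg_of_pos (termNorm_nonneg h0) hδ
  have hm : ∀ k, 0 < m t k + δ := fun k => add_pos_of_nonneg_of_pos (h0 k) hδ
  refine ⟨∑ e, P.c e * (P.termNorm e w *
      ((∑ k ∈ P.S e, P.termGrad e (m t) k * v k) / (P.termNorm e (m t) + δ)) +
      ∑ k ∈ P.S e, P.logWeight e w k * (v k / (m t k + δ))), ?_, ?_⟩
  · rw [sum_grad_mul]
    refine Finset.sum_le_sum fun e _ => mul_le_mul_of_nonneg_left ?_ (P.c_nonneg e)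
    rw [Finset.sum_div, Finset.mul_sum, ← Finset.sum_add_distrib]
    refine Finset.sum_le_sum fun k hk => ?_
    have := mul_le_mul_of_nonneg_left (termGrad_mul_div_le hδ h0 hw hk) (hv0 k)
    calc P.termGrad e (m t) k * (v k * (w k / (m t k + δ)))
        = v k * (P.termGrad e (m t) k * (w k / (m t k + δ))) := by ring
      _ ≤ _ := this
      _ = _ := by ring
  · unfold logPotential
    refine HasDerivWithinAt.fun_sum fun e _ => HasDerivWithinAt.const_mul _ (.add ?_ ?_)
    · exact (((hasDerivWithinAt_termNorm h0 (fun k _ => hv k) fun k _ => hz k).add_const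
        δ).log (hT e).ne').const_mul _
    · exact HasDerivWithinAt.fun_sum fun k _ =>
        (((hv k).add_const δ).log (hm k).ne').const_mul _

theorem logPotential_mono {δ : ℝ} (hδ : 0 < δ) (hw : ∀ k, 0 ≤ w k) (hx : ∀ k, 0 ≤ x k)
    (hxy : ∀ k, x k ≤ y k) : P.logPotential δ w x ≤ P.logPotential δ w y := by
  refine Finset.sum_le_sum fun e _ => mul_le_mul_of_nonneg_left (add_le_add ?_ ?_) (P.c_nonneg e)
  · have h1 : 0 ≤ P.termNorm e x := termNorm_nonneg hx
    exact mul_le_mul_of_nonneg_left (Real.log_le_log (by positivity)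
      (by linarith [termNorm_mono (P := P) (e := e) hx hxy])) (termNorm_nonneg hw)
  · exact Finset.sum_le_sum fun k _ => mul_le_mul_of_nonneg_left
      (Real.log_le_log (by linarith [hx k]) (by linarith [hxy k])) (logWeight_nonneg hw)

theorem continuousOn_logPotential_comp {δ : ℝ} (hδ : 0 < δ) {m : ℝ → Fin n → ℝ} {s : Set ℝ}
    (hm : ContinuousOn m s) (h0 : ∀ t ∈ s, ∀ k, 0 ≤ m t k) :
    ContinuousOn (fun t => P.logPotential δ w (m t)) s := by
  unfold logPotential
  refine continuousOn_finsetSum _ fun e _ => continuousOn_const.mul (.add ?_ ?_)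
  · refine continuousOn_const.mul (ContinuousOn.log ((continuous_termNorm.comp_continuousOn
      hm).add continuousOn_const) fun t ht => ?_)
    exact (add_pos_of_nonneg_of_pos (termNorm_nonneg (h0 t ht)) hδ).ne'
  · refine continuousOn_finsetSum _ fun k _ => continuousOn_const.mul (ContinuousOn.log
      (((continuous_apply k).comp_continuousOn hm).add continuousOn_const) fun t ht => ?_)
    exact (add_pos_of_nonneg_of_pos (h0 t ht k) hδ).ne'

/-- The total growth of the logarithmic potential on the box `[0, M]ⁿ`. -/
theorem logPotential_sub_zero_le {δ M : ℝ} {d : ℕ} (hd : 1 ≤ d) (hδ : 0 < δ) (hM : 0 ≤ M)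
    (hw : ∀ k, 0 ≤ w k) (hx : ∀ k, 0 ≤ x k) (hxM : ∀ k, x k ≤ M)
    (hcard : ∀ e, (P.S e).card ≤ d) :
    P.logPotential δ w x - P.logPotential δ w (fun _ => 0) ≤
      (Real.log (1 + d * (M / δ)) + Real.log (1 + M / δ)) * P.val w := by
  have hlog : ∀ a b : ℝ, 0 ≤ a → a ≤ b → Real.log (a + δ) - Real.log δ ≤ Real.log (1 + b / δ) := by
    intro a b ha hab
    rw [← Real.log_div (by positivity) hδ.ne']
    refine Real.log_le_log (by positivity) ?_
    rw [add_div, div_self hδ.ne', add_comm]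
    gcongr
  rw [logPotential, logPotential, ← Finset.sum_sub_distrib, val_eq, Finset.mul_sum]
  refine Finset.sum_le_sum fun e _ => ?_
  rw [← mul_sub, mul_left_comm]
  refine mul_le_mul_of_nonneg_left ?_ (P.c_nonneg e)
  rw [termNorm_zero, zero_add, add_sub_add_comm, ← mul_sub, ← Finset.sum_sub_distrib, add_mul]
  refine add_le_add ?_ ?_
  · rw [mul_comm]
    refine mul_le_mul_of_nonneg_right ?_ (termNorm_nonneg hw)
    rw [← mul_div_assoc]
    exact hlog _ _ (termNorm_nonneg hx) (termNorm_le_card_mul hd hM hx hxM (hcard e))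
  · rw [← sum_logWeight hw, Finset.mul_sum]
    refine Finset.sum_le_sum fun k _ => ?_
    rw [← mul_sub, mul_comm]
    exact mul_le_mul_of_nonneg_right (hlog _ _ (hx k) (hxM k)) (logWeight_nonneg hw)

end LqObjective

/-! ### Growth of the objective during one loop -/

namespace LqCover

variable {n r : ℕ} {P : LqObjective n r} {d : ℕ} {lam : ℝ} {x' a x z w : Fin n → ℝ} {T : ℝ}
  {u : ℝ → Fin n → ℝ}

theorem remainingAdvice_nonneg (hx' : ∀ j, 0 ≤ x' j) (y : Fin n → ℝ) (j : Fin n) :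
    0 ≤ remainingAdvice x' y j := by
  unfold remainingAdvice
  split_ifs
  exacts [hx' j, le_rfl]

theorem dotProduct_remainingAdvice_nonneg (ha : ∀ j, 0 ≤ a j) (hx' : ∀ j, 0 ≤ x' j)
    (y : Fin n → ℝ) : 0 ≤ a ⬝ᵥ remainingAdvice x' y :=
  Finset.sum_nonneg fun j _ => mul_nonneg (ha j) (remainingAdvice_nonneg hx' y j)

theorem additiveTerm_nonneg (ha : ∀ j, 0 ≤ a j) (hx' : ∀ j, 0 ≤ x' j) (hl0 : 0 ≤ lam)
    (hl1 : lam ≤ 1) (y : Fin n → ℝ) (j : Fin n) : 0 ≤ additiveTerm d lam x' a y j := by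
  have h1 := remainingAdvice_nonneg hx' y j
  have h2 := dotProduct_remainingAdvice_nonneg ha hx' y
  have h3 := ha j
  have h4 : 0 ≤ 1 - lam := by linarith
  unfold additiveTerm
  split_ifs <;> positivity

/-- If the row is unsatisfied by `y` but satisfied by the advice, part of the advice remains. -/
theorem dotProduct_remainingAdvice_pos (ha : ∀ j, 0 ≤ a j) (hx' : ∀ j, 0 ≤ x' j)
    {y : Fin n → ℝ} (hy0 : ∀ j, 0 ≤ y j) (hadv : 1 ≤ a ⬝ᵥ x') (hy : a ⬝ᵥ y < 1) :
    0 < a ⬝ᵥ remainingAdvice x' y := by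
  refine (dotProduct_remainingAdvice_nonneg ha hx' _).lt_of_ne fun h0 => ?_
  have hz : ∀ k, a k * remainingAdvice x' y k = 0 := fun k =>
    (Finset.sum_eq_zero_iff_of_nonneg fun k _ =>
      mul_nonneg (ha k) (remainingAdvice_nonneg hx' y k)).1 h0.symm k (Finset.mem_univ k)
  have : a ⬝ᵥ x' ≤ a ⬝ᵥ y := by
    refine Finset.sum_le_sum fun k _ => ?_
    have hzk := hz k
    unfold remainingAdvice at hzk
    split_ifs at hzk with hlt
    · rw [hzk]; exact mul_nonneg (ha k) (hy0 k)
    · exact mul_le_mul_of_nonneg_left (not_lt.1 hlt) (ha k)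
  linarith

theorem sum_mul_div_le (ha : ∀ j, 0 ≤ a j) (hd : 1 ≤ d) (hsupp : Set.ncard {j | 0 < a j} ≤ d)
    {c : ℝ} (hc : 0 ≤ c) : ∑ j, a j * (c / (a j * d)) ≤ c := by
  have hd' : (0 : ℝ) < d := by exact_mod_cast hd
  have h1 : ∀ j, a j * (c / (a j * d)) = if 0 < a j then c / d else 0 := by
    intro j
    split_ifs with h
    · field_simp
    · rw [le_antisymm (not_lt.1 h) (ha j), zero_mul]
  simp only [h1]
  rw [← Finset.sum_filter, Finset.sum_const, nsmul_eq_mul]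
  have h2 : ((Finset.univ.filter fun j => 0 < a j).card : ℝ) ≤ d := by
    rw [Set.ncard_eq_toFinset_card'] at hsupp
    simpa using hsupp
  calc ((Finset.univ.filter fun j => 0 < a j).card : ℝ) * (c / d) ≤ d * (c / d) := by gcongr
    _ = c := by field_simp

theorem sum_mul_additiveTerm_le (ha : ∀ j, 0 ≤ a j) (hd : 1 ≤ d)
    (hsupp : Set.ncard {j | 0 < a j} ≤ d) (hl0 : 0 ≤ lam)
    (hl1 : lam ≤ 1) (y : Fin n → ℝ) : ∑ j, a j * additiveTerm d lam x' a y j ≤ 1 := by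
  unfold additiveTerm
  split_ifs
  · simp only [mul_add, Finset.sum_add_distrib]
    have h1 := sum_mul_div_le ha hd hsupp hl0
    have h2 : ∑ j, a j * ((1 - lam) * remainingAdvice x' y j / (a ⬝ᵥ remainingAdvice x' y)) =
        (1 - lam) * ((a ⬝ᵥ remainingAdvice x' y) / (a ⬝ᵥ remainingAdvice x' y)) := by
      rw [dotProduct, Finset.sum_div, Finset.mul_sum]
      exact Finset.sum_congr rfl fun j _ => by ring
    -- Only `≤ 1` is available: the quotient is `0` by convention when no advice remains on the row.
    have h3 := div_self_le_one (a ⬝ᵥ remainingAdvice x' y)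
    rw [h2]
    nlinarith
  · exact sum_mul_div_le ha hd hsupp zero_le_one

namespace IsLoop

theorem nonneg (h : IsLoop P d lam x' a x z T u) (hx : ∀ j, 0 ≤ x j) {t : ℝ} (ht : t ∈ Icc 0 T)
    (j : Fin n) : 0 ≤ u t j :=
  (hx j).trans <| by
    rw [← h.start]
    exact h.monotoneOn (left_mem_Icc.2 h.duration_nonneg) ht ht.1 j

theorem le_finish (h : IsLoop P d lam x' a x z T u) (j : Fin n) : x j ≤ z j := by
  rw [← h.start, ← h.finish]
  exact h.monotoneOn (left_mem_Icc.2 h.duration_nonneg) (right_mem_Icc.2 h.duration_nonneg)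
    h.duration_nonneg j

theorem duration_pos (h : IsLoop P d lam x' a x z T u) (hax : a ⬝ᵥ x < 1) : 0 < T := by
  refine h.duration_nonneg.lt_of_ne fun hT => ?_
  have : x = z := by rw [← h.start, ← h.finish, hT]
  exact absurd h.satisfied (not_le.2 (this ▸ hax))

/-- By continuity the loop cannot overshoot. This is what later bounds every raised coordinate. -/
theorem dotProduct_finish_le (h : IsLoop P d lam x' a x z T u) (hax : a ⬝ᵥ x < 1) :
    a ⬝ᵥ z ≤ 1 := by
  have hT := h.duration_pos hax
  have hc : ContinuousOn (fun t => a ⬝ᵥ u t) (Icc 0 T) := by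
    unfold dotProduct
    exact continuousOn_finsetSum _ fun j _ =>
      continuousOn_const.mul ((continuous_apply j).comp_continuousOn h.continuousOn)
  have ht : Tendsto (fun t => a ⬝ᵥ u t) (𝓝[Ioo 0 T] T) (𝓝 (a ⬝ᵥ u T)) :=
    (hc T (right_mem_Icc.2 hT.le)).mono_left (nhdsWithin_mono _ Ioo_subset_Icc_self)
  have : (𝓝[Ioo 0 T] T).NeBot := right_nhdsWithin_Ioo_neBot hT
  rw [← h.finish]
  exact le_of_tendsto ht (eventually_mem_nhdsWithin.mono fun t ht =>
    (h.unsatisfied t ⟨ht.1.le, ht.2⟩).le)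

/-- At all but finitely many times, all coordinates have a derivative; it vanishes at zero
coordinates and satisfies the rate equation. -/
theorem exists_velocity (h : IsLoop P d lam x' a x z T u) (ha : ∀ j, 0 ≤ a j)
    (hx : ∀ j, 0 ≤ x j) :
    ∃ E : Set ℝ, E.Finite ∧ ∀ t ∈ Ioo 0 T \ E, ∃ v : Fin n → ℝ,
      (∀ j, 0 ≤ v j) ∧ (∀ j, HasDerivWithinAt (fun s => u s j) (v j) (Ici t) t) ∧
      (∀ j, u t j = 0 → v j = 0) ∧
      ∀ j, P.grad (u t) j * v j = a j * (u t j + additiveTerm d lam x' a (u t) j) := by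
  obtain ⟨E, hE, hrate⟩ := h.rate
  refine ⟨E, hE, fun t ht => ?_⟩
  have hmono : ∀ j, MonotoneOn (fun s => u s j) (Icc 0 T) := fun j s hs s' hs' hss =>
    h.monotoneOn hs hs' hss j
  have key : ∀ j, ∃ v : ℝ, HasDerivAt (fun s => u s j) v t ∧
      P.grad (u t) j * v = a j * (u t j + additiveTerm d lam x' a (u t) j) := by
    intro j
    rcases (ha j).eq_or_lt with h0 | hpos
    · refine ⟨0, ?_, by rw [← h0]; ring⟩
      refine (hasDerivAt_const t (x j)).congr_of_eventuallyEq ?_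
      filter_upwards [Icc_mem_nhds ht.1.1 ht.1.2] with s hs
      exact h.inactive s hs j h0.symm
    · exact hrate t ht j hpos
  choose v hv heq using key
  refine ⟨v, fun j => ?_, fun j => (hv j).hasDerivWithinAt, fun j hj => ?_, heq⟩
  · have hu : UniqueDiffWithinAt ℝ (Icc 0 T) t :=
      uniqueDiffOn_Icc (ht.1.1.trans ht.1.2) t (Ioo_subset_Icc_self ht.1)
    rw [← (hv j).hasDerivWithinAt.derivWithin hu]
    exact (hmono j).derivWithin_nonneg
  · have hu : UniqueDiffWithinAt ℝ (Icc 0 t) t :=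
      uniqueDiffOn_Icc ht.1.1 t (right_mem_Icc.2 ht.1.1.le)
    -- A nonnegative nondecreasing function that is zero at `t` is zero before `t`, so its left
    -- derivative, and hence its derivative, is zero.
    have h0 : HasDerivWithinAt (fun s => u s j) 0 (Icc 0 t) t := by
      refine (hasDerivWithinAt_const t (Icc 0 t) (0 : ℝ)).congr (fun s hs => ?_) hj
      have hs' : s ∈ Icc 0 T := ⟨hs.1, hs.2.trans ht.1.2.le⟩
      exact le_antisymm ((hmono j hs' (Ioo_subset_Icc_self ht.1) hs.2).trans hj.le)
        (h.nonneg hx hs' j)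
    exact hu.eq_deriv _ (hv j).hasDerivWithinAt h0

/-- Comparison of the growth of the objective with the growth of a potential. -/
theorem val_sub_le (h : IsLoop P d lam x' a x z T u) (ha : ∀ j, 0 ≤ a j) (hd : 1 ≤ d)
    (hsupp : Set.ncard {j | 0 < a j} ≤ d) (hl0 : 0 ≤ lam) (hl1 : lam ≤ 1) (hx : ∀ j, 0 ≤ x j)
    {B : (Fin n → ℝ) → ℝ} {K : ℝ}
    (hB : ContinuousOn (fun t => B (u t)) (Icc 0 T))
    (hBd : ∀ t ∈ Ioo 0 T, ∀ v : Fin n → ℝ, (∀ j, 0 ≤ v j) →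
      (∀ j, HasDerivWithinAt (fun s => u s j) (v j) (Ici t) t) → (∀ j, u t j = 0 → v j = 0) →
      (∀ j, P.grad (u t) j * v j = a j * (u t j + additiveTerm d lam x' a (u t) j)) →
      ∃ D, 2 ≤ K * D ∧ HasDerivWithinAt (fun s => B (u s)) D (Ici t) t) :
    P.val z - P.val x ≤ K * (B z - B x) := by
  obtain ⟨E, hE, hv⟩ := h.exists_velocity ha hx
  have key := le_of_rightDeriv_nonneg_off_finite hE (g := fun t => K * B (u t) - P.val (u t))
    h.duration_nonneg
    ((continuousOn_const.mul hB).sub (LqObjective.continuous_val.comp_continuousOn h.continuousOn))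
    (by
      intro t ht
      obtain ⟨v, hv0, hvd, hvz, heq⟩ := hv t ht
      obtain ⟨D, hD, hDd⟩ := hBd t ht.1 v hv0 hvd hvz heq
      refine ⟨_, ?_, (hDd.const_mul K).sub
        (LqObjective.hasDerivWithinAt_val (h.nonneg hx (Ioo_subset_Icc_self ht.1)) hvd hvz)⟩
      -- One unit comes from `a · u < 1`, the other from the additive terms.
      have h1 : ∑ k, P.grad (u t) k * v k ≤ 2 := by
        simp only [heq, mul_add, Finset.sum_add_distrib]
        have h2 := sum_mul_additiveTerm_le (x' := x') ha hd hsupp hl0 hl1 (u t)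
        have h3 : ∑ j, a j * u t j < 1 := h.unsatisfied t ⟨ht.1.1.le, ht.1.2⟩
        linarith
      linarith)
  simp only [h.start, h.finish] at key
  linarith

/-- The growth of the objective is paid for by the logarithmic potential as long as the additive
terms are bounded below. -/
theorem val_sub_le_logPotential (h : IsLoop P d lam x' a x z T u) (ha : ∀ j, 0 ≤ a j)
    (hd : 1 ≤ d) (hsupp : Set.ncard {j | 0 < a j} ≤ d) (hl0 : 0 ≤ lam) (hl1 : lam ≤ 1)
    (hx : ∀ j, 0 ≤ x j) {δ : ℝ} (hδ : 0 < δ) (hw : ∀ j, 0 ≤ w j) (haw : 1 ≤ a ⬝ᵥ w)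
    (hD : ∀ y : Fin n → ℝ, ∀ j, 0 < a j → δ ≤ additiveTerm d lam x' a y j) :
    P.val z - P.val x ≤ 2 * (P.logPotential δ w z - P.logPotential δ w x) := by
  refine h.val_sub_le ha hd hsupp hl0 hl1 hx
    (LqObjective.continuousOn_logPotential_comp hδ h.continuousOn fun t ht => h.nonneg hx ht) ?_
  intro t ht v hv0 hvd hvz heq
  have hu := h.nonneg hx (Ioo_subset_Icc_self ht)
  obtain ⟨D, hD1, hD2⟩ := LqObjective.exists_hasDerivWithinAt_logPotential (P := P) hδ hw hu hv0
    hvd hvz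
  refine ⟨D, ?_, hD2⟩
  -- The rate equation replaces `∇_k f(u) v_k` by `a_k (u_k + D_k)`, and `(u_k + D_k) / (u_k + δ) ≥
  -- 1`.
  have h1 : a ⬝ᵥ w ≤ ∑ k, P.grad (u t) k * (v k * (w k / (u t k + δ))) := by
    refine Finset.sum_le_sum fun k _ => ?_
    rw [← mul_assoc, heq]
    rcases (ha k).eq_or_lt with h0 | hpos
    · simp [← h0]
    · have huk := hu k
      have := hD (u t) k hpos
      have hwk := hw k
      rw [mul_assoc]
      refine mul_le_mul_of_nonneg_left ?_ (ha k)
      rw [mul_div_assoc', le_div_iff₀ (by positivity), mul_comm]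
      gcongr
  linarith

/-- The growth of the objective in a loop for a row satisfied by the advice is paid for by the
growth of the objective of the truncation to the advice. -/
theorem val_sub_le_advice (h : IsLoop P d lam x' a x z T u) (ha : ∀ j, 0 ≤ a j)
    (hd : 1 ≤ d) (hsupp : Set.ncard {j | 0 < a j} ≤ d) (hl0 : 0 ≤ lam) (hl1 : lam < 1)
    (hx : ∀ j, 0 ≤ x j) (hx' : ∀ j, 0 ≤ x' j) (hadv : 1 ≤ a ⬝ᵥ x') :
    P.val z - P.val x ≤ 2 * (1 / (1 - lam)) *
      (P.val (fun j => min (z j) (x' j)) - P.val (fun j => min (x j) (x' j))) := by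
  have hl : 0 < 1 - lam := by linarith
  refine h.val_sub_le (B := fun y => P.val fun j => min (y j) (x' j)) ha hd hsupp hl0 hl1.le hx
    (LqObjective.continuous_val.comp_continuousOn (continuousOn_pi.2 fun j =>
      ((continuous_apply j).min continuous_const).comp_continuousOn h.continuousOn)) ?_
  intro t ht v hv0 hvd hvz heq
  have hu := h.nonneg hx (Ioo_subset_Icc_self ht)
  have hm0 : ∀ k, 0 ≤ min (u t k) (x' k) := fun k => le_min (hu k) (hx' k)
  refine ⟨_, ?_, LqObjective.hasDerivWithinAt_val (m := fun s k => min (u s k) (x' k))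
    (v := fun k => if u t k < x' k then v k else 0) hm0 ?_ ?_⟩
  · have hgrad : ∀ k, u t k < x' k →
        P.grad (u t) k * v k ≤ P.grad (fun k => min (u t k) (x' k)) k * v k := by
      intro k hk
      rcases (hu k).eq_or_lt with h0 | hpos
      · rw [hvz k h0.symm]; simp
      · refine mul_le_mul_of_nonneg_right ?_ (hv0 k)
        rw [LqObjective.grad_eq, LqObjective.grad_eq]
        refine Finset.sum_le_sum fun e he => mul_le_mul_of_nonneg_left ?_ (P.c_nonneg e)
        have hke := (Finset.mem_filter.1 he).2
        rw [LqObjective.termGrad, LqObjective.termGrad, min_eq_left hk.le]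
        refine mul_le_mul_of_nonneg_left ?_ (Real.rpow_nonneg hpos.le _)
        refine Real.rpow_le_rpow_of_nonpos ?_ (LqObjective.powSum_mono hm0
          fun k => min_le_left _ _) (P.one_div_q_sub_one_nonpos e)
        exact LqObjective.powSum_pos hm0 hke (by rw [min_eq_left hk.le]; exact hpos)
    have hrem : 0 < a ⬝ᵥ remainingAdvice x' (u t) :=
      dotProduct_remainingAdvice_pos ha hx' hu hadv (h.unsatisfied t ⟨ht.1.le, ht.2⟩)
    -- The terms `a_k u_k` and the `λ`-part are discarded; the advice parts of the unreached
    -- coordinates alone add up to `1 - λ`.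
    have hsum : 1 - lam ≤ ∑ k, P.grad (fun k => min (u t k) (x' k)) k *
        (if u t k < x' k then v k else 0) := by
      calc 1 - lam = (1 - lam) * ((a ⬝ᵥ remainingAdvice x' (u t)) /
            (a ⬝ᵥ remainingAdvice x' (u t))) := by rw [div_self hrem.ne', mul_one]
        _ = ∑ k, a k * ((1 - lam) * remainingAdvice x' (u t) k /
            (a ⬝ᵥ remainingAdvice x' (u t))) := by
          rw [dotProduct, Finset.sum_div, Finset.mul_sum]
          exact Finset.sum_congr rfl fun k _ => by ring
        _ ≤ _ := by
          refine Finset.sum_le_sum fun k _ => ?_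
          split_ifs with hk
          · refine le_trans ?_ (hgrad k hk)
            rw [heq]
            refine mul_le_mul_of_nonneg_left ?_ (ha k)
            rw [additiveTerm, if_pos hadv]
            have h1 := hu k
            have h2 := ha k
            have : 0 ≤ lam / (a k * d) := by positivity
            linarith
          · rw [remainingAdvice, if_neg hk]; simp
    calc (2 : ℝ) = 2 * (1 / (1 - lam)) * (1 - lam) := by field_simp
      _ ≤ _ := mul_le_mul_of_nonneg_left hsum (by positivity)
  · intro k
    split_ifs with hk
    · refine (hvd k).congr_of_eventuallyEq ?_ (min_eq_left hk.le)
      filter_upwards [(hvd k).continuousWithinAt.eventually (gt_mem_nhds hk)] with s hs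
      exact min_eq_left hs.le
    -- A coordinate that has reached its advice stays above it. At the moment of crossing, the
    -- truncation has in general only a right derivative.
    · refine (hasDerivWithinAt_const t (Ici t) (x' k)).congr_of_eventuallyEq ?_
        (min_eq_right (not_lt.1 hk))
      filter_upwards [Icc_mem_nhdsGE ht.2] with s hs
      exact min_eq_right ((not_lt.1 hk).trans (h.monotoneOn (Ioo_subset_Icc_self ht)
        ⟨ht.1.le.trans hs.1, hs.2⟩ hs.1 k))
  · intro k hk
    split_ifs with hlt
    · simp only [min_eq_left hlt.le] at hk
      exact hvz k hk
    · rfl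

end IsLoop
end LqCover

/-! ### The optimum and the condition number -/

namespace LqObjective

variable {n r m : ℕ} {P : LqObjective n r} {x z : Fin n → ℝ}

/-- Changing free coordinates does not change the objective. -/
theorem val_congr_of_free (h : ∀ j, ¬ P.IsFree j → z j = x j) : P.val z = P.val x := by
  rw [val_eq, val_eq]
  refine Finset.sum_congr rfl fun e _ => ?_
  by_cases hc : P.c e = 0
  · simp [hc]
  · have : P.powSum e z = P.powSum e x :=
      Finset.sum_congr rfl fun k hk => by rw [h k fun hf => hc (hf e hk)]
    rw [termNorm, termNorm, this]

/-- Each row is satisfied through one chosen positive column. Without a feasible point the infimum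
defining `opt` would be the junk value `0`. -/
theorem exists_feasible {A : Matrix (Fin m) (Fin n) ℝ} (hA : ∀ i, IsCoveringRow (A i)) :
    ∃ w : Fin n → ℝ, (∀ j, 0 ≤ w j) ∧ ∀ i, 1 ≤ (A *ᵥ w) i := by
  choose p hp using fun i => (hA i).2
  have hinv : ∀ i j, 0 ≤ if p i = j then 1 / A i j else 0 := by
    intro i j
    split_ifs
    · exact one_div_nonneg.2 ((hA i).1 j)
    · exact le_rfl
  have hw : ∀ j, 0 ≤ ∑ i, if p i = j then 1 / A i j else 0 := fun j =>
    Finset.sum_nonneg fun i _ => hinv i j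
  refine ⟨fun j => ∑ i, if p i = j then 1 / A i j else 0, hw, fun i => ?_⟩
  calc 1 = A i (p i) * (1 / A i (p i)) := by rw [mul_one_div_cancel (hp i).ne']
    _ ≤ A i (p i) * ∑ i', if p i' = p i then 1 / A i' (p i) else 0 := by
        refine mul_le_mul_of_nonneg_left ?_ (hp i).le
        have := Finset.single_le_sum (f := fun i' => if p i' = p i then 1 / A i' (p i) else 0)
          (fun i' _ => hinv i' (p i)) (Finset.mem_univ i)
        simpa using this
    _ ≤ _ := Finset.single_le_sum
        (f := fun j => A i j * ∑ i', if p i' = j then 1 / A i' j else 0)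
        (fun j _ => mul_nonneg ((hA i).1 j) (hw j)) (Finset.mem_univ (p i))

theorem opt_nonneg (A : Matrix (Fin m) (Fin n) ℝ) : 0 ≤ P.opt A := by
  refine Real.sInf_nonneg ?_
  rintro _ ⟨w, hw, rfl⟩
  exact val_nonneg hw.1

/-- Comparison with every feasible point passes to the infimum, so no minimizer is needed; for `K =
0` a single feasible point suffices. -/
theorem le_add_mul_opt {A : Matrix (Fin m) (Fin n) ℝ} (hA : ∀ i, IsCoveringRow (A i))
    {V B K : ℝ} (hK : 0 ≤ K)
    (h : ∀ w : Fin n → ℝ, (∀ j, 0 ≤ w j) → (∀ i, 1 ≤ (A *ᵥ w) i) → V ≤ B + K * P.val w) :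
    V ≤ B + K * P.opt A := by
  obtain ⟨w, hw0, hw⟩ := exists_feasible hA
  rcases hK.eq_or_lt with rfl | hK
  · simpa using h w hw0 hw
  · have : (V - B) / K ≤ P.opt A := by
      refine le_csInf ⟨_, w, ⟨hw0, hw⟩, rfl⟩ ?_
      rintro _ ⟨y, hy, rfl⟩
      rw [div_le_iff₀ hK]
      linarith [h y hy.1 hy.2]
    rw [div_le_iff₀ hK] at this
    linarith

theorem card_le_dim (A : Matrix (Fin m) (Fin n) ℝ) (e : Fin r) : (P.S e).card ≤ P.dim A :=
  (Finset.le_sup (f := fun e => (P.S e).card) (Finset.mem_univ e)).trans (le_max_right _ _)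

theorem ncard_le_dim (A : Matrix (Fin m) (Fin n) ℝ) (i : Fin m) :
    Set.ncard {j | 0 < A i j} ≤ P.dim A :=
  (Finset.le_sup (f := fun i => Set.ncard {j | 0 < A i j}) (Finset.mem_univ i)).trans
    (le_max_left _ _)

end LqObjective

/-- Bounds for the positive entries of a matrix realizing the condition number. -/
theorem exists_entry_bounds {m n : ℕ} (A : Matrix (Fin m) (Fin n) ℝ)
    (h : ∃ i j, 0 < A i j) :
    ∃ lo hi : ℝ, 0 < lo ∧ lo ≤ hi ∧ condNumber A = hi / lo ∧
      ∀ i j, 0 < A i j → lo ≤ A i j ∧ A i j ≤ hi := by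
  set s := {a | 0 < a ∧ ∃ i j, A i j = a} with hs
  have hfin : s.Finite := by
    refine (Set.finite_range fun p : Fin m × Fin n => A p.1 p.2).subset ?_
    rintro a ⟨_, i, j, rfl⟩
    exact ⟨(i, j), rfl⟩
  obtain ⟨i, j, hij⟩ := h
  have hmem : ∀ i j, 0 < A i j → A i j ∈ s := fun i j h => ⟨h, i, j, rfl⟩
  have hne : s.Nonempty := ⟨_, hmem i j hij⟩
  have hb : ∀ i j, 0 < A i j → sInf s ≤ A i j ∧ A i j ≤ sSup s := fun i j h =>
    ⟨csInf_le hfin.bddBelow (hmem i j h), le_csSup hfin.bddAbove (hmem i j h)⟩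
  exact ⟨sInf s, sSup s, (hne.csInf_mem hfin).1, (hb i j hij).1.trans (hb i j hij).2, rfl, hb⟩

theorem OnlineCoveringAlgorithm.output_nonneg {n : ℕ} (alg : OnlineCoveringAlgorithm n) (l : List (Fin n → ℝ))
    (hl : ∀ b ∈ l, IsCoveringRow b) (j : Fin n) : 0 ≤ alg.output l j := by
  induction l using List.reverseRecOn with
  | nil => exact alg.nonneg_nil j
  | append_singleton l b ih =>
    have hl' : ∀ b ∈ l, IsCoveringRow b := fun b hb => hl b (by simp [hb])
    exact (ih hl').trans (alg.mono l hl' b (hl b (by simp)) j)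

/-! ### From single rounds to the competitive bounds -/

namespace LqCover

variable {n r : ℕ} {P : LqObjective n r} {d : ℕ} {lam : ℝ} {x' a x z : Fin n → ℝ}

theorem le_one_div_of_dotProduct_le (ha : ∀ j, 0 ≤ a j) (hz : ∀ j, 0 ≤ z j) (h : a ⬝ᵥ z ≤ 1)
    {j : Fin n} (hj : 0 < a j) : z j ≤ 1 / a j := by
  rw [le_div_iff₀ hj, mul_comm]
  exact (Finset.single_le_sum (f := fun j => a j * z j) (fun k _ => mul_nonneg (ha k) (hz k))
    (Finset.mem_univ j)).trans h

namespace IsRound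

theorem le (h : IsRound P d lam x' a x z) (j : Fin n) : x j ≤ z j := by
  rcases h with ⟨_, rfl⟩ | ⟨_, _, h, _⟩ | ⟨_, _, T, u, h⟩
  exacts [le_rfl, h j, h.le_finish j]

theorem covers (h : IsRound P d lam x' a x z) : 1 ≤ a ⬝ᵥ z := by
  rcases h with ⟨h, rfl⟩ | ⟨_, _, _, _, h⟩ | ⟨_, _, T, u, h⟩
  exacts [h, h.ge, h.satisfied]

/-- A round that raises anything ends with `a · z = 1`, so raised coordinates are at most `1 / a_j`;
the others do not move. -/
theorem le_of_one_div_le (h : IsRound P d lam x' a x z) (ha : ∀ j, 0 ≤ a j) (hx : ∀ j, 0 ≤ x j)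
    {M : ℝ} (hM : ∀ j, 0 < a j → 1 / a j ≤ M) (hxM : ∀ j, x j ≤ M) (j : Fin n) : z j ≤ M := by
  have hz : ∀ j, 0 ≤ z j := fun j => (hx j).trans (h.le j)
  rcases h with ⟨_, rfl⟩ | ⟨_, _, _, hj, h⟩ | ⟨hax, _, T, u, h⟩
  · exact hxM j
  · by_cases hf : 0 < a j ∧ P.IsFree j
    · exact (le_one_div_of_dotProduct_le ha hz h.le hf.1).trans (hM j hf.1)
    · rw [hj j hf]; exact hxM j
  · rcases (ha j).eq_or_lt with h0 | hpos
    · rw [← h.finish, h.inactive T (right_mem_Icc.2 h.duration_nonneg) j h0.symm]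
      exact hxM j
    · exact (le_one_div_of_dotProduct_le ha hz (h.dotProduct_finish_le hax) hpos).trans
        (hM j hpos)

/-- Only the loop costs anything: the other two kinds of round leave the objective unchanged, and
there monotonicity of the potential suffices. -/
theorem val_sub_le (h : IsRound P d lam x' a x z) {B : (Fin n → ℝ) → ℝ} (hB : B x ≤ B z)
    (hloop : ∀ T u, a ⬝ᵥ x < 1 → IsLoop P d lam x' a x z T u → P.val z - P.val x ≤ B z - B x) :
    P.val z - P.val x ≤ B z - B x := by
  rcases h with ⟨_, rfl⟩ | ⟨_, _, _, hj, _⟩ | ⟨hax, _, T, u, h⟩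
  · simp
  · rw [LqObjective.val_congr_of_free (z := z) (x := x) fun j hf => hj j fun h => hf h.2]
    linarith
  · exact hloop T u hax h

end IsRound

namespace Implements

variable {alg : OnlineCoveringAlgorithm n}

theorem output_le (h : Implements alg P d lam x') {M : ℝ} (hM0 : 0 ≤ M) (l : List (Fin n → ℝ))
    (hl : ∀ b ∈ l, IsCoveringRow b) (hM : ∀ b ∈ l, ∀ j, 0 < b j → 1 / b j ≤ M) (j : Fin n) :
    alg.output l j ≤ M := by
  induction l using List.reverseRecOn generalizing j with
  | nil => rw [h.1 j]; exact hM0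
  | append_singleton l b ih =>
    have hl' : ∀ b ∈ l, IsCoveringRow b := fun b hb => hl b (by simp [hb])
    have hb : IsCoveringRow b := hl b (by simp)
    exact (h.2 l hl' b hb).le_of_one_div_le hb.1 (alg.output_nonneg l hl') (hM b (by simp))
      (fun j => ih hl' (fun b hb => hM b (by simp [hb])) j) j

/-- A monotone potential that pays for every loop pays for the whole run. -/
theorem val_output_le (h : Implements alg P d lam x') {B : (Fin n → ℝ) → ℝ}
    (hB : ∀ x y : Fin n → ℝ, (∀ j, 0 ≤ x j) → (∀ j, x j ≤ y j) → B x ≤ B y)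
    (l : List (Fin n → ℝ)) (hl : ∀ b ∈ l, IsCoveringRow b)
    (hloop : ∀ b ∈ l, ∀ x z T u, (∀ j, 0 ≤ x j) →
      IsLoop P d lam x' b x z T u → P.val z - P.val x ≤ B z - B x) :
    P.val (alg.output l) ≤ B (alg.output l) - B (fun _ => 0) := by
  induction l using List.reverseRecOn with
  | nil =>
    have : alg.output [] = fun _ => 0 := funext h.1
    rw [this, LqObjective.val_zero, sub_self]
  | append_singleton l b ih =>
    have hl' : ∀ b ∈ l, IsCoveringRow b := fun b hb => hl b (by simp [hb])
    have hb : IsCoveringRow b := hl b (by simp)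
    have h0 := alg.output_nonneg l hl'
    have hr := h.2 l hl' b hb
    have h1 := hr.val_sub_le (hB _ _ h0 hr.le)
      fun T u _ hL => hloop b (by simp) _ _ T u h0 hL
    linarith [ih hl' fun b hb => hloop b (by simp [hb])]

end Implements

/-- This fixes the offset `δ` of the logarithmic potential when all rows must be covered; the next
lemma allows the larger offset without `λ` on rows that the advice violates. -/
theorem div_le_additiveTerm (hd : 1 ≤ d) (ha : ∀ j, 0 ≤ a j) (hx' : ∀ j, 0 ≤ x' j) (hl0 : 0 ≤ lam)
    (hl1 : lam ≤ 1) {hi : ℝ} (y : Fin n → ℝ) {j : Fin n} (hj : 0 < a j) (hhi : a j ≤ hi) :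
    lam / (hi * d) ≤ additiveTerm d lam x' a y j := by
  have hd' : (0 : ℝ) < d := by exact_mod_cast hd
  have h1 := remainingAdvice_nonneg hx' y j
  have h2 := dotProduct_remainingAdvice_nonneg ha hx' y
  have h4 : 0 ≤ 1 - lam := by linarith
  have h5 : lam / (hi * d) ≤ lam / (a j * d) := by gcongr
  unfold additiveTerm
  split_ifs
  · have : 0 ≤ (1 - lam) * remainingAdvice x' y j / (a ⬝ᵥ remainingAdvice x' y) := by positivity
    linarith
  · exact h5.trans (by gcongr)

theorem one_div_le_additiveTerm (hd : 1 ≤ d) {hi : ℝ} (y : Fin n → ℝ) {j : Fin n} (hj : 0 < a j)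
    (hhi : a j ≤ hi) (hadv : ¬ 1 ≤ a ⬝ᵥ x') : 1 / (hi * d) ≤ additiveTerm d lam x' a y j := by
  have hd' : (0 : ℝ) < d := by exact_mod_cast hd
  rw [additiveTerm, if_neg hadv]
  gcongr

/-- From `D ≤ R` and `R ≥ 1` follow `1 + D R ≤ 2 R²` and `1 + R ≤ 2 R`; finally `2 log 2 < 3`. -/
theorem log_add_log_le {R D : ℝ} (hR : 1 ≤ R) (hD : 0 ≤ D) (hDR : D ≤ R) :
    Real.log (1 + D * R) + Real.log (1 + R) ≤ 3 * (1 + Real.log R) := by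
  have hR0 : 0 < R := by linarith
  have h1 : Real.log (1 + D * R) ≤ Real.log 2 + (Real.log R + Real.log R) := by
    rw [← Real.log_mul hR0.ne' hR0.ne', ← Real.log_mul two_ne_zero (by positivity)]
    exact Real.log_le_log (by positivity) (by nlinarith)
  have h2 : Real.log (1 + R) ≤ Real.log 2 + Real.log R := by
    rw [← Real.log_mul two_ne_zero hR0.ne']
    exact Real.log_le_log (by positivity) (by linarith)
  linarith [Real.log_two_lt_d9]

/-- The growth of the logarithmic potential along a run. -/
theorem logPotential_growth_le {lo hi c : ℝ} (hd : 1 ≤ d) (hlo : 0 < lo) (hlh : lo ≤ hi)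
    (hc0 : 0 < c) (hc1 : c ≤ 1) {w : Fin n → ℝ} (hw : ∀ j, 0 ≤ w j) (hx : ∀ j, 0 ≤ x j)
    (hxM : ∀ j, x j ≤ 1 / lo) (hcard : ∀ e, (P.S e).card ≤ d) :
    P.logPotential (c / (hi * d)) w x - P.logPotential (c / (hi * d)) w (fun _ => 0) ≤
      3 * (1 + Real.log (hi / lo * d / c)) * P.val w := by
  have hd' : (1 : ℝ) ≤ d := by exact_mod_cast hd
  have hhi : 0 < hi := hlo.trans_le hlh
  have hκ : 1 ≤ hi / lo := (one_le_div hlo).2 hlh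
  -- The ratio of the box size to the offset is exactly `κ d / c`, and it dominates `d`.
  have hR : (1 / lo) / (c / (hi * d)) = hi / lo * d / c := by field_simp
  have hdR : (d : ℝ) ≤ hi / lo * d / c := by
    rw [le_div_iff₀ hc0]
    nlinarith
  refine (LqObjective.logPotential_sub_zero_le (M := 1 / lo) hd (by positivity) (by positivity) hw
    hx hxM hcard).trans ?_
  rw [hR]
  exact mul_le_mul_of_nonneg_right (log_add_log_le (hd'.trans hdR) (by positivity) hdR)
    (LqObjective.val_nonneg hw)

/-- The competitive ratio of every implementation. -/
theorem Implements.competitive {alg : OnlineCoveringAlgorithm n} (h : Implements alg P d lam x')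
    (hd : 1 ≤ d) (hl0 : 0 ≤ lam) (hl1 : lam ≤ 1) (hx' : ∀ j, 0 ≤ x' j) {m : ℕ}
    (A : Matrix (Fin m) (Fin n) ℝ) (hA : ∀ i, IsCoveringRow (A i)) (hdim : P.dim A = d) :
    (lam < 1 → P.val (alg.output (List.ofFn A)) ≤
      6 * (1 / (1 - lam)) * P.val x' + 6 * (1 + Real.log (condNumber A * d)) * P.opt A) ∧
    (0 < lam → P.val (alg.output (List.ofFn A)) ≤
      6 * (1 + Real.log (condNumber A * d / lam)) * P.opt A) ∧
    (lam < 1 → (∀ i, 1 ≤ (A *ᵥ x') i) →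
      P.val (alg.output (List.ofFn A)) ≤ 6 * (1 / (1 - lam)) * P.val x') := by
  have hvx' : 0 ≤ P.val x' := LqObjective.val_nonneg hx'
  have hopt : 0 ≤ P.opt A := LqObjective.opt_nonneg A
  rcases m.eq_zero_or_pos with rfl | hm
  · have hnil : List.ofFn A = [] := List.ofFn_zero
    have hout : alg.output (List.ofFn A) = fun _ => 0 := hnil ▸ funext h.1
    have hκ : condNumber A = 0 := by
      have : {a | 0 < a ∧ ∃ i j, A i j = a} = ∅ := by
        ext a
        simp
      rw [condNumber, this, Real.sSup_empty, zero_div]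
    -- Without rows `condNumber` is `0` and `Real.log 0 = 0`, so the right-hand sides are still
    -- nonnegative.
    rw [hout, LqObjective.val_zero, hκ, zero_mul, zero_div, Real.log_zero]
    refine ⟨fun hl => ?_, fun _ => by positivity, fun hl _ => ?_⟩ <;>
      have : 0 < 1 - lam := sub_pos.2 hl
    all_goals positivity
  obtain ⟨lo, hi, hlo, hlh, hκ, hbd⟩ := exists_entry_bounds A ⟨⟨0, hm⟩, (hA ⟨0, hm⟩).2⟩
  have hhi : 0 < hi := hlo.trans_le hlh
  have hd' : (1 : ℝ) ≤ d := by exact_mod_cast hd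
  have hd0 : (0 : ℝ) < d := by linarith
  have hκ1 : 1 ≤ hi / lo := (one_le_div hlo).2 hlh
  have hcard : ∀ e, (P.S e).card ≤ d := fun e => hdim ▸ LqObjective.card_le_dim A e
  have hsupp : ∀ i, Set.ncard {j | 0 < A i j} ≤ d := fun i => hdim ▸ LqObjective.ncard_le_dim A i
  have hmem : ∀ b ∈ List.ofFn A, ∃ i, A i = b := fun b hb =>
    List.mem_ofFn.1 hb
  have hl : ∀ b ∈ List.ofFn A, IsCoveringRow b := fun b hb => by
    obtain ⟨i, rfl⟩ := hmem b hb
    exact hA i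
  have hx0 := alg.output_nonneg (List.ofFn A) hl
  have hxM : ∀ j, alg.output (List.ofFn A) j ≤ 1 / lo := h.output_le (by positivity) _ hl (by
    intro b hb j hj
    obtain ⟨i, rfl⟩ := hmem b hb
    exact one_div_le_one_div_of_le hlo (hbd i j hj).1)
  have hΨ0 : ∀ y : Fin n → ℝ, (∀ j, 0 ≤ y j) → 0 ≤ P.val (fun j => min (y j) (x' j)) := fun y hy =>
    LqObjective.val_nonneg fun j => le_min (hy j) (hx' j)
  have hΨ1 : P.val (fun j => min (alg.output (List.ofFn A) j) (x' j)) ≤ P.val x' :=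
    LqObjective.val_mono (fun j => le_min (hx0 j) (hx' j)) fun j => min_le_right _ _
  have hΨm : ∀ x y : Fin n → ℝ, (∀ j, 0 ≤ x j) → (∀ j, x j ≤ y j) →
      P.val (fun j => min (x j) (x' j)) ≤ P.val (fun j => min (y j) (x' j)) := fun x y hx hxy =>
    LqObjective.val_mono (fun j => le_min (hx j) (hx' j)) fun j => min_le_min_right _ (hxy j)
  refine ⟨fun hlam => ?_, fun hlam => ?_, fun hlam hadv => ?_⟩
  · have hlam' : 0 < 1 - lam := sub_pos.2 hlam
    have hlog : 0 ≤ Real.log (condNumber A * d) := Real.log_nonneg (by rw [hκ]; nlinarith)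
    refine LqObjective.le_add_mul_opt hA (by positivity) fun w hw0 hw => ?_
    have hδ : 0 < 1 / (hi * d) := by positivity
    -- The sum of both potentials: in each loop one of them pays, depending on whether the advice
    -- satisfies the row, and the other does not decrease.
    have key := h.val_output_le (B := fun y => 2 * (1 / (1 - lam)) *
      P.val (fun j => min (y j) (x' j)) + 2 * P.logPotential (1 / (hi * d)) w y)
      (fun x y hx hxy => add_le_add
        (mul_le_mul_of_nonneg_left (hΨm x y hx hxy) (by positivity))
        (mul_le_mul_of_nonneg_left (LqObjective.logPotential_mono hδ hw0 hx hxy) zero_le_two))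
      (List.ofFn A) hl (by
        intro b hb x z T u hx hL
        obtain ⟨i, rfl⟩ := hmem b hb
        have hxz := hL.le_finish
        by_cases hadv : 1 ≤ A i ⬝ᵥ x'
        · have h1 := hL.val_sub_le_advice (hA i).1 hd (hsupp i) hl0 hlam hx hx' hadv
          have h2 := LqObjective.logPotential_mono (P := P) hδ hw0 hx hxz
          linarith
        · have h1 := hL.val_sub_le_logPotential (hA i).1 hd (hsupp i) hl0 hl1 hx hδ hw0 (hw i)
            fun y j hj => one_div_le_additiveTerm hd y hj (hbd i j hj).2 hadv
          have h2 := mul_le_mul_of_nonneg_left (hΨm x z hx hxz)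
            (by positivity : 0 ≤ 2 * (1 / (1 - lam)))
          linarith)
    have hg := logPotential_growth_le (P := P) hd hlo hlh one_pos le_rfl hw0 hx0 hxM hcard
    rw [div_one] at hg
    have h1 := mul_le_mul_of_nonneg_left hΨ1 (by positivity : 0 ≤ 2 * (1 / (1 - lam)))
    have h2 := mul_nonneg (by positivity : 0 ≤ 2 * (1 / (1 - lam))) (hΨ0 (fun _ => 0) fun _ => le_rfl)
    have h3 : 0 ≤ 1 / (1 - lam) * P.val x' := by positivity
    rw [hκ]
    simp only at key
    linarith
  · have hlog : 0 ≤ Real.log (condNumber A * d / lam) := Real.log_nonneg (by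
      rw [hκ, le_div_iff₀ hlam]; nlinarith)
    have : P.val (alg.output (List.ofFn A)) ≤
        0 + 6 * (1 + Real.log (condNumber A * d / lam)) * P.opt A := by
      refine LqObjective.le_add_mul_opt hA (by positivity) fun w hw0 hw => ?_
      have hδ : 0 < lam / (hi * d) := by positivity
      have key := h.val_output_le (B := fun y => 2 * P.logPotential (lam / (hi * d)) w y)
        (fun x y hx hxy =>
          mul_le_mul_of_nonneg_left (LqObjective.logPotential_mono hδ hw0 hx hxy) zero_le_two)
        (List.ofFn A) hl (by
          intro b hb x z T u hx hL
          obtain ⟨i, rfl⟩ := hmem b hb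
          have h1 := hL.val_sub_le_logPotential (hA i).1 hd (hsupp i) hl0 hl1 hx hδ hw0 (hw i)
            fun y j hj => div_le_additiveTerm hd (hA i).1 hx' hl0 hl1 y hj (hbd i j hj).2
          linarith)
      have hg := logPotential_growth_le (P := P) hd hlo hlh hlam hl1 hw0 hx0 hxM hcard
      rw [hκ]
      linarith
    linarith
  · have hlam' : 0 < 1 - lam := sub_pos.2 hlam
    have key := h.val_output_le (B := fun y => 2 * (1 / (1 - lam)) *
      P.val (fun j => min (y j) (x' j)))
      (fun x y hx hxy => mul_le_mul_of_nonneg_left (hΨm x y hx hxy) (by positivity))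
      (List.ofFn A) hl (by
        intro b hb x z T u hx hL
        obtain ⟨i, rfl⟩ := hmem b hb
        have h1 := hL.val_sub_le_advice (hA i).1 hd (hsupp i) hl0 hlam hx hx' (hadv i)
        linarith)
    have h1 := mul_le_mul_of_nonneg_left hΨ1 (by positivity : 0 ≤ 2 * (1 / (1 - lam)))
    have h2 := mul_nonneg (by positivity : 0 ≤ 2 * (1 / (1 - lam))) (hΨ0 (fun _ => 0) fun _ => le_rfl)
    have h3 : 0 ≤ 1 / (1 - lam) * P.val x' := by positivity
    linarith

end LqCover

/-! ### Difference inequalities for the rate equation -/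

namespace LqObjective

variable {n r : ℕ} {P : LqObjective n r} {x y x₁ y₁ : Fin n → ℝ} {j : Fin n}

/-- The partial derivative of the objective with its increasing part evaluated at `x` and its
decreasing part evaluated at `y`. -/
noncomputable def mixedGrad (P : LqObjective n r) (x y : Fin n → ℝ) (j : Fin n) : ℝ :=
  ∑ e with j ∈ P.S e, P.c e * (x j ^ (P.q e - 1) * P.powSum e y ^ (1 / P.q e - 1))

theorem mixedGrad_self (x : Fin n → ℝ) (j : Fin n) : P.mixedGrad x x j = P.grad x j := by
  rw [grad_eq]; rfl

/-- The exponents `q - 1` and `1/q - 1` have opposite signs. Along a monotone path the true gradient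
thus lies between two mixed ones. Positivity of `y₁ j` matters because `0` to a negative power is
`0` here. -/
theorem mixedGrad_mono (hx : 0 ≤ x j) (hxx : x j ≤ x₁ j) (hy₁ : ∀ k, 0 ≤ y₁ k)
    (hpos : 0 < y₁ j) (hyy : ∀ k, y₁ k ≤ y k) : P.mixedGrad x y j ≤ P.mixedGrad x₁ y₁ j := by
  refine Finset.sum_le_sum fun e he => mul_le_mul_of_nonneg_left ?_ (P.c_nonneg e)
  have hj := (Finset.mem_filter.1 he).2
  refine mul_le_mul (Real.rpow_le_rpow hx hxx (sub_nonneg.2 (P.one_le_q e))) ?_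
    (Real.rpow_nonneg (powSum_nonneg fun k => (hy₁ k).trans (hyy k)) _)
    (Real.rpow_nonneg (hx.trans hxx) _)
  exact Real.rpow_le_rpow_of_nonpos (powSum_pos hy₁ hj hpos) (powSum_mono hy₁ hyy)
    (P.one_div_q_sub_one_nonpos e)

theorem mixedGrad_pos (hj : ¬ P.IsFree j) (hx : 0 < x j) (hy : ∀ k, 0 ≤ y k) (hyj : 0 < y j) :
    0 < P.mixedGrad x y j := by
  unfold IsFree at hj
  push Not at hj
  obtain ⟨e, he, hc⟩ := hj
  refine Finset.sum_pos' (fun e _ => mul_nonneg (P.c_nonneg e)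
    (mul_nonneg (Real.rpow_nonneg hx.le _) (Real.rpow_nonneg (powSum_nonneg hy) _)))
    ⟨e, by simp [he], ?_⟩
  exact mul_pos ((P.c_nonneg e).lt_of_ne' hc) (mul_pos (Real.rpow_pos_of_pos hx _)
    (Real.rpow_pos_of_pos (powSum_pos hy he hyj) _))

theorem grad_pos (hj : ¬ P.IsFree j) (hx : ∀ k, 0 ≤ x k) (hxj : 0 < x j) : 0 < P.grad x j :=
  mixedGrad_self (P := P) x j ▸ mixedGrad_pos hj hxj hx hxj

/-- Each partial derivative `(x_j / ‖x‖)^(q-1)` is at most `1`. This gives a lower bound on growth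
rates that does not depend on the starting point. -/
theorem grad_le_sum (hx : ∀ k, 0 ≤ x k) (hxj : 0 < x j) : P.grad x j ≤ ∑ e, P.c e := by
  rw [grad_eq]
  calc ∑ e with j ∈ P.S e, P.c e * P.termGrad e x j ≤ ∑ e with j ∈ P.S e, P.c e := by
        refine Finset.sum_le_sum fun e he => ?_
        have hj := (Finset.mem_filter.1 he).2
        have hle := le_termNorm (P := P) hx hj
        refine mul_le_of_le_one_right (P.c_nonneg e) ?_
        rw [termGrad_eq_div hx (hxj.trans_le hle)]
        exact Real.rpow_le_one (div_nonneg hxj.le (hxj.le.trans hle))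
          (div_le_one_of_le₀ hle (hxj.le.trans hle)) (sub_nonneg.2 (P.one_le_q e))
    _ ≤ ∑ e, P.c e := Finset.sum_le_sum_of_subset_of_nonneg (Finset.filter_subset _ _)
        fun e _ _ => P.c_nonneg e

/-- On bounded sets a power of the coordinate `j` is controlled by the partial derivative. -/
theorem exists_rpow_le_mul_grad (hj : ¬ P.IsFree j) (H : Fin n → ℝ) :
    ∃ p L : ℝ, 1 ≤ p ∧ 0 ≤ L ∧ ∀ y : Fin n → ℝ, (∀ k, 0 ≤ y k) → (∀ k, y k ≤ H k) → 0 < y j →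
      p * y j ^ (p - 1) ≤ L * P.grad y j := by
  unfold IsFree at hj
  push Not at hj
  obtain ⟨e, he, hc⟩ := hj
  have hc' : 0 < P.c e := (P.c_nonneg e).lt_of_ne' hc
  have hq := P.q_pos e
  by_cases hH : (∀ k, 0 ≤ H k) ∧ 0 < H j
  · have hQ : 0 < P.powSum e H := powSum_pos hH.1 he hH.2
    have hQ' : 0 < P.powSum e H ^ (1 / P.q e - 1) := Real.rpow_pos_of_pos hQ _
    refine ⟨P.q e, P.q e / (P.c e * P.powSum e H ^ (1 / P.q e - 1)), P.one_le_q e,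
      by positivity, fun y hy hyH hyj => ?_⟩
    have h1 : P.c e * (y j ^ (P.q e - 1) * P.powSum e H ^ (1 / P.q e - 1)) ≤ P.grad y j := by
      rw [← mixedGrad_self]
      calc _ ≤ P.c e * (y j ^ (P.q e - 1) * P.powSum e y ^ (1 / P.q e - 1)) := by
            refine mul_le_mul_of_nonneg_left (mul_le_mul_of_nonneg_left ?_
              (Real.rpow_nonneg hyj.le _)) hc'.le
            exact Real.rpow_le_rpow_of_nonpos (powSum_pos hy he hyj) (powSum_mono hy hyH)
              (P.one_div_q_sub_one_nonpos e)
        _ ≤ _ := Finset.single_le_sum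
            (f := fun e => P.c e * (y j ^ (P.q e - 1) * P.powSum e y ^ (1 / P.q e - 1)))
            (fun e _ => mul_nonneg (P.c_nonneg e) (mul_nonneg (Real.rpow_nonneg hyj.le _)
              (Real.rpow_nonneg (powSum_nonneg hy) _))) (by simp [he])
    rw [div_mul_eq_mul_div, le_div_iff₀ (by positivity), mul_assoc]
    refine mul_le_mul_of_nonneg_left ?_ hq.le
    linarith
  -- The box then contains no admissible `y`, and the bound is vacuous.
  · refine ⟨1, 0, le_rfl, le_rfl, fun y hy hyH hyj => absurd ⟨fun k => (hy k).trans (hyH k),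
      hyj.trans_le (hyH j)⟩ hH⟩

theorem continuous_powSum {e : Fin r} : Continuous (P.powSum e) :=
  continuous_finsetSum _ fun k _ => (continuous_apply k).rpow_const fun _ =>
    Or.inr (P.q_pos e).le

theorem tendsto_mixedGrad {ι : Type*} {l : Filter ι} {f g : ι → Fin n → ℝ}
    (hf : Tendsto f l (𝓝 x)) (hg : Tendsto g l (𝓝 y)) (hy : ∀ k, 0 ≤ y k) (hyj : 0 < y j) :
    Tendsto (fun i => P.mixedGrad (f i) (g i) j) l (𝓝 (P.mixedGrad x y j)) := by
  unfold mixedGrad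
  refine tendsto_finsetSum _ fun e he => tendsto_const_nhds.mul (.mul ?_ ?_)
  · exact (((continuous_apply j).tendsto x).comp hf).rpow_const
      (Or.inr (sub_nonneg.2 (P.one_le_q e)))
  · exact ((continuous_powSum.tendsto y).comp hg).rpow_const
      (Or.inl (powSum_pos hy (Finset.mem_filter.1 he).2 hyj).ne')

/-- Finite-difference form of the rate equation with constant additive terms `D` for the
coordinates in `M`, stopped when `a · w = 1`. All conditions are closed under pointwise limits.
The bounds `p` and `L` control the modulus of continuity. -/
structure IsFlow (P : LqObjective n r) (a D p L : Fin n → ℝ) (M : Finset (Fin n)) (T : ℝ)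
    (y : Fin n → ℝ) (w : ℝ → Fin n → ℝ) : Prop where
  start : w 0 = y
  nonneg : ∀ k, 0 ≤ y k
  mono : MonotoneOn w (Icc 0 T)
  const : ∀ t ∈ Icc 0 T, ∀ j ∉ M, w t j = y j
  le_one : ∀ t ∈ Icc 0 T, a ⬝ᵥ w t ≤ 1
  finish : a ⬝ᵥ w T = 1
  upper : ∀ s ∈ Icc 0 T, ∀ t ∈ Icc 0 T, s ≤ t → a ⬝ᵥ w t < 1 → ∀ j ∈ M, 0 < w s j →
    (w t j - w s j) * P.mixedGrad (w s) (w t) j ≤ (t - s) * (a j * (w t j + D j))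
  lower : ∀ s ∈ Icc 0 T, ∀ t ∈ Icc 0 T, s ≤ t → a ⬝ᵥ w t < 1 → ∀ j ∈ M, 0 < w s j →
    (t - s) * (a j * (w s j + D j)) ≤ (w t j - w s j) * P.mixedGrad (w t) (w s) j
  lower_const : ∀ s ∈ Icc 0 T, ∀ t ∈ Icc 0 T, s ≤ t → a ⬝ᵥ w t < 1 → ∀ j ∈ M,
    (t - s) * (a j * (w s j + D j)) ≤ (w t j - w s j) * ∑ e, P.c e
  holder : ∀ s ∈ Icc 0 T, ∀ t ∈ Icc 0 T, s ≤ t → ∀ j ∈ M,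
    w t j ^ p j - w s j ^ p j ≤ L j * (t - s)

namespace IsFlow

variable {a D p L : Fin n → ℝ} {M : Finset (Fin n)} {T : ℝ} {w : ℝ → Fin n → ℝ}

theorem start_le (h : IsFlow P a D p L M T y w) {t : ℝ} (ht : t ∈ Icc 0 T) (j : Fin n) :
    y j ≤ w t j := by
  rw [← h.start]
  exact h.mono (left_mem_Icc.2 (ht.1.trans ht.2)) ht ht.1 j

theorem nonneg' (h : IsFlow P a D p L M T y w) {t : ℝ} (ht : t ∈ Icc 0 T) (j : Fin n) :
    0 ≤ w t j := (h.nonneg j).trans (h.start_le ht j)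

/-- The inequalities are non-strict, while their guards `a · w < 1` and `0 < w_j` are open and hence
hold eventually along the filter; positivity of the coordinate also makes the mixed gradient
continuous. -/
theorem of_tendsto {ι : Type*} {l : Filter ι} [l.NeBot] {ys : ι → Fin n → ℝ}
    {ws : ι → ℝ → Fin n → ℝ} (hT : 0 ≤ T) (hp : ∀ j, 1 ≤ p j)
    (h : ∀ i, IsFlow P a D p L M T (ys i) (ws i))
    (hlim : ∀ t ∈ Icc 0 T, Tendsto (fun i => ws i t) l (𝓝 (w t))) :
    IsFlow P a D p L M T (w 0) w := by
  have h0T : (0 : ℝ) ∈ Icc 0 T := left_mem_Icc.2 hT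
  have hc : ∀ t ∈ Icc 0 T, ∀ j, Tendsto (fun i => ws i t j) l (𝓝 (w t j)) := fun t ht j =>
    ((continuous_apply j).tendsto _).comp (hlim t ht)
  have hdot : ∀ t ∈ Icc 0 T, Tendsto (fun i => a ⬝ᵥ ws i t) l (𝓝 (a ⬝ᵥ w t)) := fun t ht =>
    tendsto_finsetSum _ fun j _ => tendsto_const_nhds.mul (hc t ht j)
  have hnn : ∀ t ∈ Icc 0 T, ∀ j, 0 ≤ w t j := fun t ht j =>
    ge_of_tendsto (hc t ht j) (Eventually.of_forall fun i => (h i).nonneg' ht j)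
  have hmono : MonotoneOn w (Icc 0 T) := fun s hs t ht hst j =>
    le_of_tendsto_of_tendsto' (hc s hs j) (hc t ht j) fun i => (h i).mono hs ht hst j
  refine ⟨rfl, hnn 0 h0T, hmono, ?_, ?_, ?_, ?_, ?_, ?_, ?_⟩
  · intro t ht j hj
    refine tendsto_nhds_unique (hc t ht j) ((hc 0 h0T j).congr fun i => ?_)
    rw [(h i).const t ht j hj, (h i).start]
  · exact fun t ht => le_of_tendsto' (hdot t ht) fun i => (h i).le_one t ht
  · have hTT : T ∈ Icc 0 T := right_mem_Icc.2 hT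
    exact tendsto_nhds_unique (hdot T hTT) (tendsto_const_nhds.congr fun i => (h i).finish.symm)
  · intro s hs t ht hst hlt j hj hpos
    have hpos' : 0 < w t j := hpos.trans_le (hmono hs ht hst j)
    refine le_of_tendsto_of_tendsto (((hc t ht j).sub (hc s hs j)).mul
      (tendsto_mixedGrad (hlim s hs) (hlim t ht) (hnn t ht) hpos'))
      (tendsto_const_nhds.mul (tendsto_const_nhds.mul ((hc t ht j).add tendsto_const_nhds))) ?_
    filter_upwards [(hdot t ht).eventually (gt_mem_nhds hlt),
      (hc s hs j).eventually (lt_mem_nhds hpos)] with i h1 h2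
    exact (h i).upper s hs t ht hst h1 j hj h2
  · intro s hs t ht hst hlt j hj hpos
    refine le_of_tendsto_of_tendsto
      (tendsto_const_nhds.mul (tendsto_const_nhds.mul ((hc s hs j).add tendsto_const_nhds)))
      (((hc t ht j).sub (hc s hs j)).mul
      (tendsto_mixedGrad (hlim t ht) (hlim s hs) (hnn s hs) hpos)) ?_
    filter_upwards [(hdot t ht).eventually (gt_mem_nhds hlt),
      (hc s hs j).eventually (lt_mem_nhds hpos)] with i h1 h2
    exact (h i).lower s hs t ht hst h1 j hj h2
  · intro s hs t ht hst hlt j hj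
    refine le_of_tendsto_of_tendsto
      (tendsto_const_nhds.mul (tendsto_const_nhds.mul ((hc s hs j).add tendsto_const_nhds)))
      (((hc t ht j).sub (hc s hs j)).mul tendsto_const_nhds) ?_
    filter_upwards [(hdot t ht).eventually (gt_mem_nhds hlt)] with i h1
    exact (h i).lower_const s hs t ht hst h1 j hj
  · intro s hs t ht hst j hj
    have hp0 : 0 ≤ p j := zero_le_one.trans (hp j)
    exact le_of_tendsto' (((hc t ht j).rpow_const (Or.inr hp0)).sub
      ((hc s hs j).rpow_const (Or.inr hp0))) fun i => (h i).holder s hs t ht hst j hj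

/-- By `holder` and monotonicity the power `w_j ^ p_j` is Lipschitz; its `p_j`-th root is
continuous. -/
theorem continuousOn (h : IsFlow P a D p L M T y w) (hp : ∀ j, 1 ≤ p j) :
    ContinuousOn w (Icc 0 T) := by
  refine continuousOn_pi.2 fun j => ?_
  by_cases hj : j ∈ M
  · have hp0 : 0 < p j := zero_lt_one.trans_le (hp j)
    have hmono : MonotoneOn (fun t => w t j ^ p j) (Icc 0 T) := fun s hs t ht hst =>
      Real.rpow_le_rpow (h.nonneg' hs j) (h.mono hs ht hst j) hp0.le
    have hlip : LipschitzOnWith (Real.toNNReal (L j)) (fun t => w t j ^ p j) (Icc 0 T) := by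
      refine LipschitzOnWith.of_le_add_mul _ fun s hs t ht => ?_
      rcases le_total s t with hst | hst
      · exact (hmono hs ht hst).trans (le_add_of_nonneg_right (by positivity))
      · have h1 := h.holder t ht s hs hst j hj
        rw [Real.dist_eq, abs_of_nonneg (sub_nonneg.2 hst)]
        have h2 := mul_le_mul_of_nonneg_right (Real.le_coe_toNNReal (L j)) (sub_nonneg.2 hst)
        linarith
    refine (hlip.continuousOn.rpow_const (p := 1 / p j) fun t _ =>
      Or.inr (one_div_pos.2 hp0).le).congr fun t ht => ?_
    beta_reduce
    rw [← Real.rpow_mul (h.nonneg' ht j), mul_one_div_cancel hp0.ne', Real.rpow_one]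
  · exact continuousOn_const.congr fun t ht => h.const t ht j hj

/-- While the row is unsatisfied, positive coordinates satisfy the rate equation. -/
theorem hasDerivAt (h : IsFlow P a D p L M T y w) (hp : ∀ j, 1 ≤ p j) {t₀ t₁ : ℝ}
    (ht₁ : t₁ ≤ T) (ht : t₀ ∈ Ioo 0 t₁) (hlt : ∀ t ∈ Ioo 0 t₁, a ⬝ᵥ w t < 1) {j : Fin n}
    (hj : j ∈ M) (hfree : ¬ P.IsFree j) (hpos : ∀ t ∈ Ioo 0 t₁, 0 < w t j) :
    HasDerivAt (fun t => w t j) (a j * (w t₀ j + D j) / P.grad (w t₀) j) t₀ := by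
  have hsub : Ioo 0 t₁ ⊆ Icc 0 T := fun t ht => ⟨ht.1.le, ht.2.le.trans ht₁⟩
  have hcont : ContinuousAt w t₀ :=
    (h.continuousOn hp).continuousAt (mem_of_superset (Ioo_mem_nhds ht.1 ht.2) hsub)
  have hmin : Tendsto (fun s => w (min s t₀)) (𝓝[≠] t₀) (𝓝 (w t₀)) := by
    refine Tendsto.mono_left ?_ nhdsWithin_le_nhds
    refine Tendsto.comp (y := 𝓝 t₀) hcont ?_
    exact Continuous.tendsto' (by fun_prop) _ _ (min_self t₀)
  have hmax : Tendsto (fun s => w (max s t₀)) (𝓝[≠] t₀) (𝓝 (w t₀)) := by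
    refine Tendsto.mono_left ?_ nhdsWithin_le_nhds
    refine Tendsto.comp (y := 𝓝 t₀) hcont ?_
    exact Continuous.tendsto' (by fun_prop) _ _ (max_self t₀)
  have hminj := ((continuous_apply j).tendsto (w t₀)).comp hmin
  have hmaxj := ((continuous_apply j).tendsto (w t₀)).comp hmax
  have hnn := h.nonneg' (hsub ht)
  have hg : P.mixedGrad (w t₀) (w t₀) j ≠ 0 := (mixedGrad_pos hfree (hpos t₀ ht) hnn
    (hpos t₀ ht)).ne'
  have hev : ∀ᶠ s in 𝓝[≠] t₀, s ∈ Ioo 0 t₁ ∧ s ≠ t₀ :=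
    (eventually_nhdsWithin_of_eventually_nhds (Ioo_mem_nhds ht.1 ht.2)).and
      eventually_mem_nhdsWithin
  rw [← mixedGrad_self, hasDerivAt_iff_tendsto_slope]
  have hslope : ∀ s, s ≠ t₀ → slope (fun t => w t j) t₀ s =
      (w (max s t₀) j - w (min s t₀) j) / (max s t₀ - min s t₀) := by
    intro s hs
    rw [slope_def_field]
    rcases le_total s t₀ with hst | hst
    · rw [max_eq_right hst, min_eq_left hst, ← neg_sub (w t₀ j), ← neg_sub t₀, neg_div_neg_eq]
    · rw [max_eq_left hst, min_eq_right hst]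
  have hmem : ∀ s ∈ Ioo 0 t₁, min s t₀ ∈ Ioo 0 t₁ ∧ max s t₀ ∈ Ioo 0 t₁ := fun s hs =>
    ⟨⟨lt_min hs.1 ht.1, (min_le_right _ _).trans_lt ht.2⟩,
      ⟨hs.1.trans_le (le_max_left _ _), max_lt hs.2 ht.2⟩⟩
  -- `lower` and `upper` squeeze the slope between quotients with mixed gradients, which both tend
  -- to the true rate; `min` and `max` treat both sides of `t₀` together.
  refine tendsto_of_tendsto_of_tendsto_of_le_of_le'
    ((tendsto_const_nhds.mul (hminj.add tendsto_const_nhds)).div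
      (tendsto_mixedGrad (j := j) hmax hmin hnn (hpos t₀ ht)) hg)
    ((tendsto_const_nhds.mul (hmaxj.add tendsto_const_nhds)).div
      (tendsto_mixedGrad (j := j) hmin hmax hnn (hpos t₀ ht)) hg) ?_ ?_
  · filter_upwards [hev] with s ⟨hs, hne⟩
    obtain ⟨h1, h2⟩ := hmem s hs
    have hlt' : 0 < max s t₀ - min s t₀ := sub_pos.2 (min_lt_max.2 hne)
    rw [hslope s hne, Pi.div_apply, div_le_div_iff₀
      (mixedGrad_pos hfree (hpos _ h2) (h.nonneg' (hsub h1)) (hpos _ h1)) hlt', mul_comm]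
    exact h.lower _ (hsub h1) _ (hsub h2) min_le_max (hlt _ h2) j hj (hpos _ h1)
  · filter_upwards [hev] with s ⟨hs, hne⟩
    obtain ⟨h1, h2⟩ := hmem s hs
    have hlt' : 0 < max s t₀ - min s t₀ := sub_pos.2 (min_lt_max.2 hne)
    rw [hslope s hne, Pi.div_apply, div_le_div_iff₀ hlt'
      (mixedGrad_pos hfree (hpos _ h1) (h.nonneg' (hsub h2)) (hpos _ h2)), mul_comm _ (max s t₀ - _)]
    exact h.upper _ (hsub h1) _ (hsub h2) min_le_max (hlt _ h2) j hj (hpos _ h1)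

end IsFlow
end LqObjective

/-! ### Tools for differential equations -/

/-- A bounded Lipschitz vector field has solutions on every compact interval. -/
theorem exists_hasDerivWithinAt_of_lipschitz {E : Type*} [NormedAddCommGroup E] [NormedSpace ℝ E]
    [CompleteSpace E] {G : E → E} {K C : NNReal} (hG : LipschitzWith K G) (hC : ∀ x, ‖G x‖ ≤ C)
    (x₀ : E) {T : ℝ} (hT : 0 ≤ T) :
    ∃ u : ℝ → E, u 0 = x₀ ∧ ∀ t ∈ Icc 0 T, HasDerivWithinAt u (G (u t)) (Icc 0 T) t := by
  -- With speed at most `C`, a solution cannot leave the ball of radius `C T` before time `T`.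
  have hpl : IsPicardLindelof (fun _ => G) (tmin := 0) (tmax := T) ⟨0, left_mem_Icc.2 hT⟩ x₀
      (C * Real.toNNReal T) 0 C K :=
    IsPicardLindelof.of_time_independent (fun x _ => hC x) hG.lipschitzOnWith (by
      simp [hT])
  exact hpl.exists_eq_forall_mem_Icc_hasDerivWithinAt₀

/-- The first time at which a continuous function reaches a level. -/
theorem exists_first_hit {g : ℝ → ℝ} {T c : ℝ} (hT : 0 ≤ T) (hg : ContinuousOn g (Icc 0 T))
    (h0 : g 0 < c) (hc : c ≤ g T) : ∃ s ∈ Ioc 0 T, g s = c ∧ ∀ t ∈ Ico 0 s, g t < c := by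
  have hcl : IsClosed (Icc 0 T ∩ g ⁻¹' Ici c) := hg.preimage_isClosed_of_isClosed isClosed_Icc
    isClosed_Ici
  obtain ⟨s, ⟨hs, hsc⟩, hmin⟩ := (isCompact_Icc.of_isClosed_subset hcl
    inter_subset_left).exists_isLeast ⟨T, right_mem_Icc.2 hT, hc⟩
  have hlt : ∀ t ∈ Ico 0 s, g t < c := fun t ht => by
    by_contra hge
    exact absurd (hmin ⟨⟨ht.1, ht.2.le.trans hs.2⟩, not_lt.1 hge⟩) (not_le.2 ht.2)
  have hs0 : 0 < s := hs.1.lt_of_ne fun h => absurd (h ▸ hsc : c ≤ g 0) (not_le.2 h0)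
  refine ⟨s, ⟨hs0, hs.2⟩, le_antisymm ?_ hsc, hlt⟩
  have ht : Tendsto g (𝓝[Ico 0 s] s) (𝓝 (g s)) :=
    (hg s hs).mono_left (nhdsWithin_mono _ fun t ht => ⟨ht.1, ht.2.le.trans hs.2⟩)
  have : (𝓝[Ico 0 s] s).NeBot := by
    rw [nhdsWithin_Ico_eq_nhdsLT hs0]; infer_instance
  exact le_of_tendsto ht (eventually_mem_nhdsWithin.mono fun t ht => (hlt t ht).le)

theorem sub_mul_le_of_deriv {g g' : ℝ → ℝ} {s t A B : ℝ} (hst : s ≤ t)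
    (hg : ContinuousOn g (Icc s t)) (hd : ∀ τ ∈ Ioo s t, HasDerivAt g (g' τ) τ)
    (hle : ∀ τ ∈ Ioo s t, g' τ * A ≤ B) : (g t - g s) * A ≤ (t - s) * B := by
  have := le_of_rightDeriv_nonneg_off_finite finite_empty (g := fun τ => τ * B - g τ * A) hst
    ((continuousOn_id.mul continuousOn_const).sub (hg.mul continuousOn_const)) fun τ hτ =>
      ⟨1 * B - g' τ * A, by linarith [hle τ hτ.1], (((hasDerivAt_id τ).mul_const B).sub
        ((hd τ hτ.1).mul_const A)).hasDerivWithinAt⟩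
  linarith

theorem le_sub_mul_of_deriv {g g' : ℝ → ℝ} {s t A B : ℝ} (hst : s ≤ t)
    (hg : ContinuousOn g (Icc s t)) (hd : ∀ τ ∈ Ioo s t, HasDerivAt g (g' τ) τ)
    (hle : ∀ τ ∈ Ioo s t, B ≤ g' τ * A) : (t - s) * B ≤ (g t - g s) * A := by
  have := sub_mul_le_of_deriv (A := -A) (B := -B) hst hg hd fun τ hτ => by
    linarith [hle τ hτ]
  linarith

/-- Coordinatewise truncation to a box. -/
def clip {n : ℕ} (lo hi x : Fin n → ℝ) (j : Fin n) : ℝ := max (lo j) (min (hi j) (x j))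

theorem clip_mem {n : ℕ} {lo hi : Fin n → ℝ} (h : lo ≤ hi) (x : Fin n → ℝ) :
    clip lo hi x ∈ Icc lo hi :=
  ⟨fun _ => le_max_left _ _, fun j => max_le (h j) (min_le_left _ _)⟩

theorem clip_of_mem {n : ℕ} {lo hi x : Fin n → ℝ} (h : x ∈ Icc lo hi) : clip lo hi x = x :=
  funext fun j => by rw [clip, min_eq_right (h.2 j), max_eq_right (h.1 j)]

theorem lipschitzWith_clip {n : ℕ} (lo hi : Fin n → ℝ) : LipschitzWith 1 (clip lo hi) :=
  LipschitzWith.of_dist_le_mul fun x y => by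
    rw [NNReal.coe_one, one_mul, dist_pi_le_iff dist_nonneg]
    intro j
    have h := ((LipschitzWith.eval (α := fun _ : Fin n => ℝ) j).const_min (hi j)).const_max (lo j)
    simpa [clip] using h.dist_le_mul x y

/-! ### Solving the rate equation from a positive starting point -/

namespace LqObjective

variable {n r : ℕ} {P : LqObjective n r} {a D y : Fin n → ℝ} {M : Finset (Fin n)} {j : Fin n}

/-- The growth rates of the coordinates in `M`; the other coordinates are kept fixed. -/
noncomputable def rateField (P : LqObjective n r) (a D : Fin n → ℝ) (M : Finset (Fin n))
    (x : Fin n → ℝ) (j : Fin n) : ℝ :=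
  if j ∈ M then a j * (x j + D j) / P.grad x j else 0

theorem contDiffAt_rateField {x : Fin n → ℝ} (hM : ∀ j ∈ M, ¬ P.IsFree j) (hx : ∀ k, 0 ≤ x k)
    (hpos : ∀ j ∈ M, 0 < x j) : ContDiffAt ℝ 1 (P.rateField a D M) x := by
  refine contDiffAt_pi.2 fun j => ?_
  unfold rateField
  by_cases hj : j ∈ M
  · simp only [if_pos hj]
    have hcoord : ∀ k, ContDiffAt ℝ 1 (fun x : Fin n → ℝ => x k) x := fun k =>
      (contDiff_apply ℝ ℝ k).contDiffAt
    refine ContDiffAt.div (contDiffAt_const.mul ((hcoord j).add contDiffAt_const)) ?_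
      (grad_pos (hM j hj) hx (hpos j hj)).ne'
    have hgrad : (fun x => P.grad x j) = fun x => ∑ e with j ∈ P.S e, P.c e * P.termGrad e x j :=
      funext fun x => P.grad_eq x j
    rw [hgrad]
    refine ContDiffAt.sum fun e he => contDiffAt_const.mul ?_
    unfold termGrad
    refine ((hcoord j).rpow_const_of_ne (hpos j hj).ne').mul (ContDiffAt.rpow_const_of_ne ?_
      (powSum_pos hx (Finset.mem_filter.1 he).2 (hpos j hj)).ne')
    unfold powSum
    refine ContDiffAt.sum fun k _ => ?_
    exact (Real.contDiff_rpow_const_of_le (n := 1) (by simpa using P.one_le_q e)).contDiffAt.comp x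
      (hcoord k)
  · simp only [if_neg hj]
    exact contDiffAt_const

/-- Truncated to a box away from zero, the rates are Lipschitz and bounded. -/
theorem exists_lipschitz_rateField_clip {lo hi : Fin n → ℝ} (hM : ∀ j ∈ M, ¬ P.IsFree j)
    (hle : lo ≤ hi) (hlo : ∀ k, 0 ≤ lo k) (hpos : ∀ j ∈ M, 0 < lo j) :
    ∃ K C : NNReal, LipschitzWith K (fun x => P.rateField a D M (clip lo hi x)) ∧
      ∀ x, ‖P.rateField a D M (clip lo hi x)‖ ≤ C := by
  have hloc : LocallyLipschitzOn (Icc lo hi) (P.rateField a D M) := by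
    intro x hx
    obtain ⟨K, t, ht, hK⟩ := (contDiffAt_rateField (a := a) (D := D) hM
      (fun k => (hlo k).trans (hx.1 k))
      fun j hj => (hpos j hj).trans_le (hx.1 j)).exists_lipschitzOnWith
    exact ⟨K, t, mem_nhdsWithin_of_mem_nhds ht, hK⟩
  obtain ⟨K, hK⟩ := hloc.exists_lipschitzOnWith_of_compact isCompact_Icc
  obtain ⟨C, hC⟩ := isCompact_Icc.exists_bound_of_continuousOn hK.continuousOn
  refine ⟨K * 1, Real.toNNReal C, ?_, fun x =>
    (hC _ (clip_mem hle x)).trans (Real.le_coe_toNNReal C)⟩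
  have := hK.comp ((lipschitzWith_clip lo hi).lipschitzOnWith (s := univ))
    fun x _ => clip_mem hle x
  exact lipschitzOnWith_univ.1 this

/-- From a positive starting point the rate equation can be solved until the row is satisfied. -/
theorem exists_isFlow_of_pos {p L H : Fin n → ℝ} {T : ℝ} (ha : ∀ j, 0 ≤ a j)
    (haM : ∀ j ∈ M, 0 < a j) (hM : ∀ j ∈ M, ¬ P.IsFree j) (hD : ∀ j, 0 ≤ D j)
    (hp : ∀ j, 1 ≤ p j) (hL0 : ∀ j, 0 ≤ L j) (hT : 0 ≤ T)
    (hL : ∀ j ∈ M, ∀ z : Fin n → ℝ, (∀ k, 0 ≤ z k) → (∀ k, z k ≤ H k) → 0 < z j →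
      p j * z j ^ (p j - 1) ≤ L j * P.grad z j)
    {j₀ : Fin n} (hj₀ : j₀ ∈ M) (hTj : ∑ e, P.c e ≤ T * (a j₀ * (a j₀ * D j₀)))
    (hyH : ∀ k, y k ≤ H k) (haH : ∀ j ∈ M, 1 / a j ≤ H j)
    (hy : ∀ k, 0 ≤ y k) (hpos : ∀ j ∈ M, 0 < y j) (hay : a ⬝ᵥ y < 1) :
    ∃ w, P.IsFlow a D p (fun j => L j * (a j * (H j + D j))) M T y w := by
  have hC0 : 0 < ∑ e, P.c e :=
    (grad_pos (hM _ hj₀) hy (hpos _ hj₀)).trans_le (grad_le_sum hy (hpos _ hj₀))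
  -- The box holds every state between `y` and satisfaction of the row, so the clipped field agrees
  -- with the true one until then.
  set hi : Fin n → ℝ := fun j => if j ∈ M then 1 / a j else y j with hhi
  have hybd : ∀ z : Fin n → ℝ, (∀ k, 0 ≤ z k) → a ⬝ᵥ z ≤ 1 → ∀ j ∈ M, z j ≤ 1 / a j :=
    fun z hz haz j hj => LqCover.le_one_div_of_dotProduct_le ha hz haz (haM j hj)
  have hle : y ≤ hi := fun j => by
    simp only [hhi]
    split_ifs with hj
    exacts [hybd y hy hay.le j hj, le_rfl]
  have hiH : ∀ k, hi k ≤ H k := fun k => by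
    simp only [hhi]
    split_ifs with hj
    exacts [haH k hj, hyH k]
  obtain ⟨K, C, hK, hC⟩ := exists_lipschitz_rateField_clip (a := a) (D := D) hM hle hy hpos
  obtain ⟨u, hu0, hud⟩ := exists_hasDerivWithinAt_of_lipschitz hK hC y hT
  have hcont : ContinuousOn u (Icc 0 T) := fun t ht => (hud t ht).continuousWithinAt
  have hcontj : ∀ j, ContinuousOn (fun t => u t j) (Icc 0 T) := fun j =>
    (continuous_apply j).comp_continuousOn hcont
  have hder : ∀ t ∈ Ioo 0 T, ∀ j, HasDerivAt (fun s => u s j)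
      (P.rateField a D M (clip y hi (u t)) j) t := fun t ht j =>
    hasDerivAt_pi.1 ((hud t (Ioo_subset_Icc_self ht)).hasDerivAt (Icc_mem_nhds ht.1 ht.2)) j
  have hclip : ∀ z, (∀ k, 0 ≤ clip y hi z k) ∧ ∀ j ∈ M, 0 < clip y hi z j := fun z =>
    ⟨fun k => (hy k).trans ((clip_mem hle z).1 k),
      fun j hj => (hpos j hj).trans_le ((clip_mem hle z).1 j)⟩
  have hrate0 : ∀ z j, 0 ≤ P.rateField a D M (clip y hi z) j := by
    intro z j
    unfold rateField
    split_ifs with hj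
    · exact div_nonneg (mul_nonneg (ha j) (add_nonneg ((hclip z).1 j) (hD j)))
        (grad_nonneg (hclip z).1)
    · exact le_rfl
  have hsub : ∀ {s t}, s ∈ Icc 0 T → t ∈ Icc 0 T → Icc s t ⊆ Icc 0 T := fun hs ht =>
    Icc_subset_Icc hs.1 ht.2
  have hsub' : ∀ {s t}, s ∈ Icc 0 T → t ∈ Icc 0 T → Ioo s t ⊆ Ioo 0 T := fun hs ht =>
    Ioo_subset_Ioo hs.1 ht.2
  have hmono : MonotoneOn u (Icc 0 T) := by
    intro s hs t ht hst j
    have := le_sub_mul_of_deriv (A := 1) (B := 0) hst ((hcontj j).mono (hsub hs ht))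
      (fun τ hτ => hder τ (hsub' hs ht hτ) j) fun τ _ => by simpa using hrate0 (u τ) j
    simpa using this
  have hconst : ∀ t ∈ Icc 0 T, ∀ j ∉ M, u t j = y j := by
    intro t ht j hj
    have h0 : (0 : ℝ) ∈ Icc 0 T := left_mem_Icc.2 hT
    have := sub_mul_le_of_deriv (A := 1) (B := 0) ht.1 ((hcontj j).mono (hsub h0 ht))
      (fun τ hτ => hder τ (hsub' h0 ht hτ) j) fun τ _ => by simp [rateField, hj]
    have h1 := hmono h0 ht ht.1 j
    rw [hu0] at h1 this
    simp only [mul_one, mul_zero, sub_nonpos] at this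
    exact le_antisymm this h1
  have hyu : ∀ t ∈ Icc 0 T, ∀ j, y j ≤ u t j := fun t ht j => by
    rw [← hu0]
    exact hmono (left_mem_Icc.2 hT) ht ht.1 j
  have hu00 : ∀ t ∈ Icc 0 T, ∀ j, 0 ≤ u t j := fun t ht j => (hy j).trans (hyu t ht j)
  have hTT : T ∈ Icc 0 T := right_mem_Icc.2 hT
  -- Since the gradient is at most `∑ c_e`, the coordinate `j₀` alone reaches `1 / a j₀` by time
  -- `T`.
  have hfin : 1 ≤ a ⬝ᵥ u T := by
    have h0 : (0 : ℝ) ∈ Icc 0 T := left_mem_Icc.2 hT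
    have := le_sub_mul_of_deriv (A := ∑ e, P.c e) (B := a j₀ * D j₀) hT (hcontj j₀)
      (fun τ hτ => hder τ hτ j₀) fun τ _ => by
        rw [rateField, if_pos hj₀, div_mul_eq_mul_div,
          le_div_iff₀ (grad_pos (hM _ hj₀) (hclip _).1 ((hclip _).2 _ hj₀))]
        have h1 := grad_le_sum (P := P) (hclip (u τ)).1 ((hclip (u τ)).2 _ hj₀)
        have h2 := (hclip (u τ)).1 j₀
        have h3 := hD j₀
        have h4 := ha j₀
        refine mul_le_mul ?_ h1 (grad_nonneg (hclip _).1) (by positivity)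
        exact mul_le_mul_of_nonneg_left (by linarith) h4
    have h1 : a j₀ * u T j₀ ≤ a ⬝ᵥ u T :=
      Finset.single_le_sum (f := fun j => a j * u T j)
        (fun k _ => mul_nonneg (ha k) (hu00 T hTT k)) (Finset.mem_univ j₀)
    refine le_trans ?_ h1
    rw [← mul_le_mul_iff_left₀ hC0, one_mul]
    have h2 : 0 ≤ u 0 j₀ := hu00 0 h0 j₀
    have h3 := mul_nonneg h2 hC0.le
    have h4 := mul_le_mul_of_nonneg_left (this.trans (by linarith :
      (u T j₀ - u 0 j₀) * ∑ e, P.c e ≤ u T j₀ * ∑ e, P.c e)) (ha j₀)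
    linarith
  have hcdot : ContinuousOn (fun t => a ⬝ᵥ u t) (Icc 0 T) := by
    unfold dotProduct
    exact continuousOn_finsetSum _ fun j _ => continuousOn_const.mul (hcontj j)
  obtain ⟨S, hS, haS, hltS⟩ := exists_first_hit hT hcdot (by rw [hu0]; exact hay) hfin
  have hle1 : ∀ t ∈ Icc 0 S, a ⬝ᵥ u t ≤ 1 := fun t ht => by
    rcases ht.2.eq_or_lt with rfl | hlt
    exacts [haS.le, (hltS t ⟨ht.1, hlt⟩).le]
  have hST : Icc 0 S ⊆ Icc 0 T := Icc_subset_Icc_right hS.2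
  have hbox : ∀ t ∈ Icc 0 S, u t ∈ Icc y hi := fun t ht => by
    refine ⟨hyu t (hST ht), fun j => ?_⟩
    simp only [hhi]
    split_ifs with hj
    exacts [hybd _ (hu00 t (hST ht)) (hle1 t ht) j hj, (hconst t (hST ht) j hj).le]
  have hpos' : ∀ t ∈ Icc 0 S, ∀ j ∈ M, 0 < u t j := fun t ht j hj =>
    (hpos j hj).trans_le ((hbox t ht).1 j)
  have hder' : ∀ t ∈ Ioo 0 S, ∀ j ∈ M, HasDerivAt (fun s => u s j)
      (a j * (u t j + D j) / P.grad (u t) j) t := by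
    intro t ht j hj
    have := hder t ⟨ht.1, ht.2.trans_le hS.2⟩ j
    rwa [clip_of_mem (hbox t (Ioo_subset_Icc_self ht)), rateField, if_pos hj] at this
  have hgpos : ∀ t ∈ Icc 0 S, ∀ j ∈ M, 0 < P.grad (u t) j := fun t ht j hj =>
    grad_pos (hM j hj) (hu00 t (hST ht)) (hpos' t ht j hj)
  have hmin : ∀ t ∈ Icc 0 T, min t S ∈ Icc 0 S := fun t ht =>
    ⟨le_min ht.1 hS.1.le, min_le_right _ _⟩
  have hltmin : ∀ t ∈ Icc 0 T, a ⬝ᵥ u (min t S) < 1 → t < S := by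
    intro t ht hlt
    by_contra hge
    rw [min_eq_right (not_lt.1 hge), haS] at hlt
    exact lt_irrefl _ hlt
  -- The solution is frozen at the hitting time `S`, so that different starting points share the
  -- interval `[0, T]`.
  refine ⟨fun t => u (min t S), ?_, hy, ?_, ?_, ?_, ?_, ?_, ?_, ?_, ?_⟩
  · simp only [min_eq_left hS.1.le, hu0]
  · intro s hs t ht hst
    exact hmono (hST (hmin s hs)) (hST (hmin t ht)) (min_le_min_right _ hst)
  · exact fun t ht j hj => hconst _ (hST (hmin t ht)) j hj
  · exact fun t ht => hle1 _ (hmin t ht)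
  · simp only [min_eq_right hS.2, haS]
  · intro s hs t ht hst hlt j hj _
    have htS := hltmin t ht hlt
    have hs' : s ∈ Icc 0 S := ⟨hs.1, (hst.trans htS.le)⟩
    have ht' : t ∈ Icc 0 S := ⟨ht.1, htS.le⟩
    simp only [min_eq_left hs'.2, min_eq_left ht'.2]
    refine sub_mul_le_of_deriv hst ((hcontj j).mono (hsub hs ht))
      (fun τ hτ => hder' τ ⟨hs.1.trans_lt hτ.1, hτ.2.trans htS⟩ j hj) fun τ hτ => ?_
    have hτ' : τ ∈ Icc 0 S := ⟨hs.1.trans hτ.1.le, hτ.2.le.trans htS.le⟩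
    have hg := hgpos τ hτ' j hj
    have h1 : P.mixedGrad (u s) (u t) j ≤ P.grad (u τ) j := by
      rw [← mixedGrad_self]
      exact mixedGrad_mono (hu00 s hs j) (hmono hs (hST hτ') hτ.1.le j) (hu00 τ (hST hτ'))
        (hpos' τ hτ' j hj) (hmono (hST hτ') ht hτ.2.le)
    have h2 : u τ j ≤ u t j := hmono (hST hτ') ht hτ.2.le j
    have h3 := hu00 τ (hST hτ') j
    have h6 := hu00 t ht j
    have h4 := hD j
    have h5 := ha j
    rw [div_mul_eq_mul_div, div_le_iff₀ hg]
    exact mul_le_mul (by gcongr) h1 (mixedGrad_pos (hM j hj) (hpos' s hs' j hj) (hu00 t ht)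
      (hpos' t ht' j hj)).le (by positivity)
  · intro s hs t ht hst hlt j hj _
    have htS := hltmin t ht hlt
    have hs' : s ∈ Icc 0 S := ⟨hs.1, (hst.trans htS.le)⟩
    have ht' : t ∈ Icc 0 S := ⟨ht.1, htS.le⟩
    simp only [min_eq_left hs'.2, min_eq_left ht'.2]
    refine le_sub_mul_of_deriv hst ((hcontj j).mono (hsub hs ht))
      (fun τ hτ => hder' τ ⟨hs.1.trans_lt hτ.1, hτ.2.trans htS⟩ j hj) fun τ hτ => ?_
    have hτ' : τ ∈ Icc 0 S := ⟨hs.1.trans hτ.1.le, hτ.2.le.trans htS.le⟩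
    have hg := hgpos τ hτ' j hj
    have h1 : P.grad (u τ) j ≤ P.mixedGrad (u t) (u s) j := by
      rw [← mixedGrad_self]
      exact mixedGrad_mono (hu00 τ (hST hτ') j) (hmono (hST hτ') ht hτ.2.le j) (hu00 s hs)
        (hpos' s hs' j hj) (hmono hs (hST hτ') hτ.1.le)
    have h2 : u s j ≤ u τ j := hmono hs (hST hτ') hτ.1.le j
    have h3 := hu00 s hs j
    have h6 := hu00 τ (hST hτ') j
    have h4 := hD j
    have h5 := ha j
    rw [div_mul_eq_mul_div, le_div_iff₀ hg]
    exact mul_le_mul (by gcongr) h1 hg.le (by positivity)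
  · intro s hs t ht hst hlt j hj
    have htS := hltmin t ht hlt
    have hs' : s ∈ Icc 0 S := ⟨hs.1, (hst.trans htS.le)⟩
    have ht' : t ∈ Icc 0 S := ⟨ht.1, htS.le⟩
    simp only [min_eq_left hs'.2, min_eq_left ht'.2]
    refine le_sub_mul_of_deriv hst ((hcontj j).mono (hsub hs ht))
      (fun τ hτ => hder' τ ⟨hs.1.trans_lt hτ.1, hτ.2.trans htS⟩ j hj) fun τ hτ => ?_
    have hτ' : τ ∈ Icc 0 S := ⟨hs.1.trans hτ.1.le, hτ.2.le.trans htS.le⟩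
    have hg := hgpos τ hτ' j hj
    have h1 := grad_le_sum (P := P) (hu00 τ (hST hτ')) (hpos' τ hτ' j hj)
    have h2 : u s j ≤ u τ j := hmono hs (hST hτ') hτ.1.le j
    have h3 := hu00 s hs j
    have h6 := hu00 τ (hST hτ') j
    have h4 := hD j
    have h5 := ha j
    rw [div_mul_eq_mul_div, le_div_iff₀ hg]
    exact mul_le_mul (by gcongr) h1 hg.le (by positivity)
  · intro s hs t ht hst j hj
    have hs' := hmin s hs
    have ht' := hmin t ht
    have hst' : min s S ≤ min t S := min_le_min_right _ hst
    have hlen : min t S - min s S ≤ t - s := by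
      rcases le_total t S with h | h <;> rcases le_total s S with h' | h' <;>
        simp only [min_eq_left h, min_eq_right h, min_eq_left h', min_eq_right h'] <;> linarith
    have hHj : 0 ≤ H j := (hy j).trans (hyH j)
    have h4 := hD j
    have h5 := ha j
    have h6 := hL0 j
    -- The derivative `p u^(p-1) u'` is bounded because `hL` cancels the gradient in the denominator
    -- of `u'`.
    have := sub_mul_le_of_deriv (g := fun τ => u τ j ^ p j) (A := 1)
      (B := L j * (a j * (H j + D j))) hst'
      ((hcontj j).mono (hsub (hST hs') (hST ht')) |>.rpow_const fun τ _ =>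
        Or.inr (zero_le_one.trans (hp j)))
      (fun τ hτ => (hder' τ ⟨hs'.1.trans_lt hτ.1, hτ.2.trans_le ht'.2⟩ j hj).rpow_const
        (Or.inr (hp j))) fun τ hτ => by
        have hτ' : τ ∈ Icc 0 S := ⟨hs'.1.trans hτ.1.le, hτ.2.le.trans ht'.2⟩
        have hg := hgpos τ hτ' j hj
        have hb := hbox τ hτ'
        have h1 := hL j hj (u τ) (hu00 τ (hST hτ')) (fun k => (hb.2 k).trans (hiH k))
          (hpos' τ hτ' j hj)
        have h2 : u τ j ≤ H j := (hb.2 j).trans (hiH j)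
        have h3 := hu00 τ (hST hτ') j
        rw [mul_one, div_mul_eq_mul_div, div_mul_eq_mul_div, div_le_iff₀ hg]
        calc a j * (u τ j + D j) * p j * u τ j ^ (p j - 1)
            = a j * (u τ j + D j) * (p j * u τ j ^ (p j - 1)) := by ring
          _ ≤ a j * (H j + D j) * (L j * P.grad (u τ) j) := by
              refine mul_le_mul (by gcongr) h1 ?_ (by positivity)
              exact mul_nonneg (zero_le_one.trans (hp j)) (Real.rpow_nonneg h3 _)
          _ = _ := by ring
    rw [mul_one, mul_comm] at this
    exact this.trans (mul_le_mul_of_nonneg_left hlen (by positivity))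

end LqObjective

/-! ### Solving with frozen additive terms from any starting point -/

namespace LqObjective

variable {n r : ℕ} {P : LqObjective n r} {a D x : Fin n → ℝ}

/-- The rate equation with constant additive terms can be solved from every starting point, until
the row is satisfied. -/
theorem exists_constant_phase (ha : ∀ j, 0 ≤ a j) (hfree : ∀ j, 0 < a j → ¬ P.IsFree j)
    (hD : ∀ j, 0 ≤ D j) (hD0 : ∃ j, 0 < a j ∧ 0 < D j) (hx : ∀ j, 0 ≤ x j) (hax : a ⬝ᵥ x < 1) :
    ∃ (T : ℝ) (w : ℝ → Fin n → ℝ), 0 < T ∧ w 0 = x ∧ ContinuousOn w (Icc 0 T) ∧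
      MonotoneOn w (Icc 0 T) ∧ (∀ t ∈ Ico 0 T, a ⬝ᵥ w t < 1) ∧ a ⬝ᵥ w T = 1 ∧
      (∀ t ∈ Icc 0 T, ∀ j, a j = 0 → w t j = x j) ∧
      ∀ t ∈ Ioo 0 T, ∀ j, 0 < a j → ∃ v : ℝ, HasDerivAt (fun s => w s j) v t ∧
        P.grad (w t) j * v = a j * (w t j + D j) := by
  classical
  -- The coordinates that must move; an active coordinate with `x_j = D_j = 0` satisfies the rate
  -- equation by staying at zero.
  set M : Finset (Fin n) := Finset.univ.filter fun j => 0 < a j ∧ (0 < D j ∨ 0 < x j) with hMdef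
  have hM : ∀ j, j ∈ M ↔ 0 < a j ∧ (0 < D j ∨ 0 < x j) := fun j => by simp [hMdef]
  obtain ⟨j₀, hj₀a, hj₀D⟩ := hD0
  have hj₀ : j₀ ∈ M := (hM j₀).2 ⟨hj₀a, Or.inl hj₀D⟩
  set H : Fin n → ℝ := fun j => max (x j + 1) (1 / a j) with hH
  have hbound : ∀ j, ∃ p L : ℝ, 1 ≤ p ∧ 0 ≤ L ∧ (j ∈ M → ∀ z : Fin n → ℝ, (∀ k, 0 ≤ z k) →
      (∀ k, z k ≤ H k) → 0 < z j → p * z j ^ (p - 1) ≤ L * P.grad z j) := by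
    intro j
    by_cases hj : j ∈ M
    · obtain ⟨p, L, hp, hL, h⟩ := exists_rpow_le_mul_grad (hfree j ((hM j).1 hj).1) H
      exact ⟨p, L, hp, hL, fun _ => h⟩
    · exact ⟨1, 0, le_rfl, le_rfl, fun h => absurd h hj⟩
  choose p L hp hL0 hL using hbound
  have hC : 0 ≤ ∑ e, P.c e := Finset.sum_nonneg fun e _ => P.c_nonneg e
  set T : ℝ := (∑ e, P.c e) / (a j₀ * (a j₀ * D j₀)) with hTdef
  have hT : 0 ≤ T := by positivity
  have hsum : 0 ≤ ∑ j, a j := Finset.sum_nonneg fun j _ => ha j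
  -- Small enough that every perturbed start is still unsatisfied and lies below `H`.
  set δ : ℝ := min 1 ((1 - a ⬝ᵥ x) / (∑ j, a j + 1)) with hδdef
  have hδ : 0 < δ := lt_min one_pos (div_pos (sub_pos.2 hax) (by positivity))
  have hδsum : δ * ∑ j, a j < 1 - a ⬝ᵥ x := by
    have h1 : δ * (∑ j, a j + 1) ≤ 1 - a ⬝ᵥ x := by
      rw [← le_div_iff₀ (by positivity)]
      exact min_le_right _ _
    linarith
  set ys : ℕ → Fin n → ℝ := fun i j => if j ∈ M then x j + δ * (1 / ((i : ℝ) + 1)) else x j with hys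
  have hinv : ∀ i : ℕ, 0 < 1 / ((i : ℝ) + 1) ∧ 1 / ((i : ℝ) + 1) ≤ 1 := fun i =>
    ⟨Nat.one_div_pos_of_nat, by rw [div_le_one (by positivity)]; simp⟩
  have hεi : ∀ i : ℕ, 0 < δ * (1 / ((i : ℝ) + 1)) ∧ δ * (1 / ((i : ℝ) + 1)) ≤ δ := fun i =>
    ⟨mul_pos hδ (hinv i).1, mul_le_of_le_one_right hδ.le (hinv i).2⟩
  have hysle : ∀ i j, ys i j ≤ x j + δ := by
    intro i j
    simp only [hys]
    split_ifs
    · linarith [(hεi i).2]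
    · linarith
  have hysge : ∀ i j, x j ≤ ys i j := by
    intro i j
    simp only [hys]
    split_ifs
    · linarith [(hεi i).1]
    · exact le_rfl
  have hysH : ∀ i j, ys i j ≤ H j := fun i j =>
    (hysle i j).trans ((add_le_add_right (min_le_left _ _) _).trans (le_max_left _ _))
  have hflow : ∀ i, ∃ w, P.IsFlow a D p (fun j => L j * (a j * (H j + D j))) M T (ys i) w := by
    intro i
    refine exists_isFlow_of_pos ha (fun j hj => ((hM j).1 hj).1)
      (fun j hj => hfree j ((hM j).1 hj).1) hD hp hL0 hT hL hj₀ ?_ ?_ ?_ ?_ ?_ ?_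
    · rw [hTdef, div_mul_cancel₀ _ (by positivity)]
    · exact hysH i
    · exact fun j _ => le_max_right _ _
    · exact fun k => (hx k).trans (hysge i k)
    · intro j hj
      simp only [hys, if_pos hj]
      linarith [hx j, (hεi i).1]
    · calc a ⬝ᵥ ys i ≤ ∑ j, (a j * x j + δ * a j) := Finset.sum_le_sum fun j _ => by
            have := mul_le_mul_of_nonneg_left (hysle i j) (ha j)
            linarith
        _ = a ⬝ᵥ x + δ * ∑ j, a j := by rw [Finset.sum_add_distrib, ← Finset.mul_sum]; rfl
        _ < 1 := by linarith
  choose ws hws using hflow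
  have hys0 : ∀ i k, 0 ≤ ys i k := fun i k => (hx k).trans (hysge i k)
  have hbox : ∀ i, ∀ t ∈ Icc 0 T, ws i t ∈ Icc (0 : Fin n → ℝ) H := by
    intro i t ht
    refine ⟨fun j => (hws i).nonneg' ht j, fun j => ?_⟩
    by_cases hj : j ∈ M
    · exact (LqCover.le_one_div_of_dotProduct_le ha (fun j => (hws i).nonneg' ht j)
        ((hws i).le_one t ht) ((hM j).1 hj).1).trans (le_max_right _ _)
    · rw [(hws i).const t ht j hj]
      exact hysH i j
  -- Compactness of the box gives limits at all times along one ultrafilter; pointwise convergence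
  -- suffices for `IsFlow.of_tendsto`.
  set l : Ultrafilter ℕ := Ultrafilter.of atTop with hl
  have hlim : ∀ t, ∃ z, t ∈ Icc 0 T → Tendsto (fun i => ws i t) l (𝓝 z) := by
    intro t
    by_cases ht : t ∈ Icc 0 T
    · obtain ⟨z, _, hz⟩ := (isCompact_Icc (a := (0 : Fin n → ℝ)) (b := H)).ultrafilter_le_nhds
        (l.map fun i => ws i t) (by
          rw [le_principal_iff]
          exact mem_map.2 (Eventually.of_forall fun i => hbox i t ht))
      exact ⟨z, fun _ => hz⟩
    · exact ⟨0, fun h => absurd h ht⟩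
  choose w hw using hlim
  have hF := IsFlow.of_tendsto hT hp hws hw
  have h0T : (0 : ℝ) ∈ Icc 0 T := left_mem_Icc.2 hT
  have hw0 : w 0 = x := by
    refine tendsto_nhds_unique (hw 0 h0T) ?_
    simp only [(hws _).start]
    refine Tendsto.mono_left ?_ (Ultrafilter.of_le atTop)
    refine tendsto_pi_nhds.2 fun j => ?_
    simp only [hys]
    split_ifs
    · have := (tendsto_one_div_add_atTop_nhds_zero_nat (𝕜 := ℝ)).const_mul δ |>.const_add (x j)
      simpa using this
    · exact tendsto_const_nhds
  have hcont := hF.continuousOn hp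
  have hcdot : ContinuousOn (fun t => a ⬝ᵥ w t) (Icc 0 T) := by
    unfold dotProduct
    exact continuousOn_finsetSum _ fun j _ =>
      continuousOn_const.mul ((continuous_apply j).comp_continuousOn hcont)
  obtain ⟨S, hS, haS, hltS⟩ := exists_first_hit hT hcdot (by rw [hw0]; exact hax) hF.finish.ge
  have hST : Icc 0 S ⊆ Icc 0 T := Icc_subset_Icc_right hS.2
  have hpos : ∀ j ∈ M, ∀ t ∈ Ioo 0 S, 0 < w t j := by
    intro j hj t ht
    have htT := hST (Ioo_subset_Icc_self ht)
    have hge := hF.start_le htT j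
    rw [hw0] at hge
    rcases ((hM j).1 hj).2 with h | h
    -- The bound with constant `∑ c_e` also applies at zero coordinates and forces them to become
    -- positive at once.
    · have h1 := hF.lower_const 0 h0T t htT ht.1.le (hltS t ⟨ht.1.le, ht.2⟩) j hj
      rw [hw0] at h1
      have h2 : 0 < (t - 0) * (a j * (x j + D j)) := by
        have := ((hM j).1 hj).1
        have := hx j
        rw [sub_zero]
        have := ht.1
        positivity
      have h3 : 0 < w t j - x j := pos_of_mul_pos_left (h2.trans_le h1) hC
      linarith [hx j]
    · linarith
  refine ⟨S, w, hS.1, hw0, hcont.mono hST, hF.mono.mono hST, hltS, haS, ?_, ?_⟩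
  · intro t ht j hj
    rw [hF.const t (hST ht) j (fun h => ((hM j).1 h).1.ne' hj), hw0]
  · intro t ht j hj
    by_cases hjM : j ∈ M
    · refine ⟨_, hF.hasDerivAt hp hS.2 ht (fun s hs => hltS s ⟨hs.1.le, hs.2⟩) hjM (hfree j hj)
        (hpos j hjM), ?_⟩
      have := grad_pos (hfree j hj) (hF.nonneg' (hST (Ioo_subset_Icc_self ht))) (hpos j hjM t ht)
      field_simp
    · have hz : ¬ (0 < D j ∨ 0 < x j) := fun h => hjM ((hM j).2 ⟨hj, h⟩)
      push Not at hz
      have hD' : D j = 0 := le_antisymm hz.1 (hD j)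
      have hx0 : x j = 0 := le_antisymm hz.2 (hx j)
      have hc : ∀ s ∈ Icc 0 S, w s j = 0 := fun s hs => by
        rw [hF.const s (hST hs) j hjM, hw0, hx0]
      refine ⟨0, ?_, by rw [hc t (Ioo_subset_Icc_self ht), hD']; ring⟩
      refine (hasDerivAt_const t (0 : ℝ)).congr_of_eventuallyEq ?_
      filter_upwards [Icc_mem_nhds ht.1 ht.2] with s hs using hc s hs

end LqObjective

/-! ### Concatenating phases, and the online algorithm -/

namespace LqCover

variable {n r : ℕ} {P : LqObjective n r} {d : ℕ} {lam : ℝ} {x' a x z : Fin n → ℝ}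

/-- The additive terms depend on the solution only through the set of unreached advice. -/
theorem additiveTerm_congr (ha : ∀ j, 0 ≤ a j) {y : Fin n → ℝ}
    (h : ∀ k, 0 < a k → (y k < x' k ↔ x k < x' k)) {j : Fin n} (hj : 0 < a j) :
    additiveTerm d lam x' a y j = additiveTerm d lam x' a x j := by
  have h1 : ∀ k, 0 < a k → remainingAdvice x' y k = remainingAdvice x' x k := fun k hk => by
    simp only [remainingAdvice, h k hk]
  have h2 : a ⬝ᵥ remainingAdvice x' y = a ⬝ᵥ remainingAdvice x' x := by
    refine Finset.sum_congr rfl fun k _ => ?_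
    rcases (ha k).eq_or_lt with h0 | hpos
    · rw [← h0, zero_mul, zero_mul]
    · rw [h1 k hpos]
  simp only [additiveTerm, h1 j hj, h2]

/-- Some active coordinate has a positive additive term. -/
theorem exists_additiveTerm_pos (hd : 1 ≤ d) (hrow : IsCoveringRow a) (hx' : ∀ j, 0 ≤ x' j)
    (hl0 : 0 ≤ lam) (hl1 : lam ≤ 1) (hx : ∀ j, 0 ≤ x j) (hax : a ⬝ᵥ x < 1) :
    ∃ j, 0 < a j ∧ 0 < additiveTerm d lam x' a x j := by
  have hd' : (0 : ℝ) < d := by exact_mod_cast hd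
  by_cases hadv : 1 ≤ a ⬝ᵥ x'
  · have hrem := dotProduct_remainingAdvice_pos hrow.1 hx' hx hadv hax
    obtain ⟨j, _, hj⟩ := Finset.exists_lt_of_sum_lt (s := Finset.univ) (f := fun _ => (0 : ℝ))
      (g := fun j => a j * remainingAdvice x' x j) (by
        rw [Finset.sum_const_zero]; exact hrem)
    have hr := remainingAdvice_nonneg hx' x j
    have haj : 0 < a j := pos_of_mul_pos_left hj hr
    have hrj : 0 < remainingAdvice x' x j := pos_of_mul_pos_right hj haj.le
    refine ⟨j, haj, ?_⟩
    rw [additiveTerm, if_pos hadv]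
    -- For `λ = 0` the advice part is positive; for `λ > 0` the uniform part is, even if `λ = 1`.
    rcases hl0.eq_or_lt with rfl | hl
    · rw [zero_div, zero_add, sub_zero, one_mul]
      positivity
    · have : 0 ≤ 1 - lam := sub_nonneg.2 hl1
      positivity
  · obtain ⟨j, hj⟩ := hrow.2
    refine ⟨j, hj, ?_⟩
    rw [additiveTerm, if_neg hadv]
    positivity

/-- A loop may be preceded by a path that satisfies the rate equation. -/
theorem IsLoop.concat {y : Fin n → ℝ} {S T : ℝ} {u w : ℝ → Fin n → ℝ} (hS : 0 < S) (hw0 : w 0 = x)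
    (hwS : w S = y) (hc : ContinuousOn w (Icc 0 S)) (hm : MonotoneOn w (Icc 0 S))
    (hlt : ∀ t ∈ Icc 0 S, a ⬝ᵥ w t < 1) (hin : ∀ t ∈ Icc 0 S, ∀ j, a j = 0 → w t j = x j)
    (hrate : ∀ t ∈ Ioo 0 S, ∀ j, 0 < a j → ∃ v : ℝ, HasDerivAt (fun s => w s j) v t ∧
      P.grad (w t) j * v = a j * (w t j + additiveTerm d lam x' a (w t) j))
    (h : IsLoop P d lam x' a y z T u) :
    IsLoop P d lam x' a x z (S + T) (fun t => if t ≤ S then w t else u (t - S)) := by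
  have hT := h.duration_nonneg
  set U : ℝ → Fin n → ℝ := fun t => if t ≤ S then w t else u (t - S) with hU
  have hU1 : ∀ t, t ≤ S → U t = w t := fun t ht => if_pos ht
  have hU2 : ∀ t, S ≤ t → U t = u (t - S) := by
    intro t ht
    rcases ht.eq_or_lt with rfl | hlt
    · rw [hU1 _ le_rfl, sub_self, h.start, hwS]
    · exact if_neg (not_le.2 hlt)
  have hsub : MapsTo (fun t => t - S) (Icc S (S + T)) (Icc 0 T) := fun t ht =>
    ⟨sub_nonneg.2 ht.1, by linarith [ht.2]⟩
  have hunion : Icc 0 (S + T) = Icc 0 S ∪ Icc S (S + T) :=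
    (Icc_union_Icc_eq_Icc hS.le (by linarith)).symm
  have hc1 : ContinuousOn U (Icc 0 S) := hc.congr fun t ht => hU1 t ht.2
  have hc2 : ContinuousOn U (Icc S (S + T)) :=
    (h.continuousOn.comp (by fun_prop) hsub).congr fun t ht => hU2 t ht.1
  have hm1 : MonotoneOn U (Icc 0 S) := hm.congr fun t ht => (hU1 t ht.2).symm
  have hm2 : MonotoneOn U (Icc S (S + T)) := fun s hs t ht hst => by
    rw [hU2 s hs.1, hU2 t ht.1]
    exact h.monotoneOn (hsub hs) (hsub ht) (by linarith)
  refine ⟨by linarith, ?_, ?_, ?_, ?_, ?_, h.satisfied, ?_, ?_⟩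
  · rw [hU1 0 hS.le, hw0]
  · rw [hU2 _ (by linarith), add_sub_cancel_left, h.finish]
  · rw [hunion]
    exact hc1.union_of_isClosed hc2 isClosed_Icc isClosed_Icc
  · rw [hunion]
    exact hm1.union_right hm2 (isGreatest_Icc hS.le) (isLeast_Icc (by linarith))
  · intro t ht
    rcases le_total t S with hle | hle
    · rw [hU1 t hle]; exact hlt t ⟨ht.1, hle⟩
    · rw [hU2 t hle]; exact h.unsatisfied _ ⟨by linarith, by linarith [ht.2]⟩
  · intro t ht j hj
    rcases le_total t S with hle | hle
    · rw [hU1 t hle]; exact hin t ⟨ht.1, hle⟩ j hj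
    · rw [hU2 t hle, h.inactive _ (hsub ⟨hle, ht.2⟩) j hj, ← hwS, hin S ⟨hS.le, le_rfl⟩ j hj]
  · obtain ⟨E, hE, hr⟩ := h.rate
    -- The junction `S` is exceptional, because the rates may jump there.
    refine ⟨insert S ((fun t => t + S) '' E), (hE.image _).insert _, fun t ht j hj => ?_⟩
    obtain ⟨ht, htE⟩ := ht
    simp only [mem_insert_iff, mem_image, not_or, not_exists, not_and] at htE
    rcases lt_or_gt_of_ne htE.1 with hlt' | hgt
    · obtain ⟨v, hv, heq⟩ := hrate t ⟨ht.1, hlt'⟩ j hj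
      refine ⟨v, hv.congr_of_eventuallyEq ?_, ?_⟩
      · filter_upwards [Iio_mem_nhds hlt'] with s hs
        rw [hU1 s (le_of_lt hs)]
      · rw [hU1 t hlt'.le]; exact heq
    · obtain ⟨v, hv, heq⟩ := hr (t - S) ⟨⟨by linarith, by linarith [ht.2]⟩, fun hmem =>
        htE.2 _ hmem (by ring)⟩ j hj
      refine ⟨v, (hv.comp_sub_const t S).congr_of_eventuallyEq ?_, ?_⟩
      · filter_upwards [Ioi_mem_nhds hgt] with s hs
        rw [hU2 s (le_of_lt hs)]
      · rw [hU2 t hgt.le]; exact heq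

/-- The continuous loop can be executed from every nonnegative solution. -/
theorem exists_isLoop (hd : 1 ≤ d) (hl0 : 0 ≤ lam) (hl1 : lam ≤ 1) (hx' : ∀ j, 0 ≤ x' j)
    (hrow : IsCoveringRow a) (hfree : ∀ j, 0 < a j → ¬ P.IsFree j) (hx : ∀ j, 0 ≤ x j)
    (hax : a ⬝ᵥ x < 1) : ∃ z T u, IsLoop P d lam x' a x z T u := by
  -- Each phase that ends early reaches the advice in at least one further active coordinate, so the
  -- number of unreached ones drops.
  induction hN : Set.ncard {k | 0 < a k ∧ x k < x' k} using Nat.strong_induction_on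
    generalizing x with
  | _ N ih =>
  obtain ⟨T, w, hT, hw0, hc, hm, hlt, hwT, hin, hrate⟩ :=
    LqObjective.exists_constant_phase hrow.1 hfree
      (additiveTerm_nonneg (d := d) hrow.1 hx' hl0 hl1 x)
      (exists_additiveTerm_pos hd hrow hx' hl0 hl1 hx hax) hx hax
  have hge : ∀ t ∈ Icc 0 T, ∀ k, x k ≤ w t k := fun t ht k => by
    rw [← hw0]
    exact hm (left_mem_Icc.2 hT.le) ht ht.1 k
  -- The times at which the frozen additive terms may be out of date; before the least element of
  -- `Z` they are correct.
  set Z : Set ℝ := ⋃ k ∈ {k | 0 < a k ∧ x k < x' k}, Icc 0 T ∩ (fun t => w t k) ⁻¹' Ici (x' k)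
    with hZ
  have hZcl : IsClosed Z := (Set.toFinite _).isClosed_biUnion fun k _ =>
    ContinuousOn.preimage_isClosed_of_isClosed ((continuous_apply k).comp_continuousOn hc)
      isClosed_Icc isClosed_Ici
  have hZsub : Z ⊆ Icc 0 T := iUnion₂_subset fun k _ => inter_subset_left
  have hZmem : ∀ t, t ∈ Z ↔ ∃ k, (0 < a k ∧ x k < x' k) ∧ t ∈ Icc 0 T ∧ x' k ≤ w t k := fun t => by
    simp only [hZ, mem_iUnion, mem_inter_iff, mem_preimage, mem_Ici, mem_ofPred_eq, exists_prop]
  have hrate' : ∀ S ≤ T, (∀ t ∈ Ico 0 S, t ∉ Z) → ∀ t ∈ Ioo 0 S, ∀ j, 0 < a j →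
      ∃ v : ℝ, HasDerivAt (fun s => w s j) v t ∧
        P.grad (w t) j * v = a j * (w t j + additiveTerm d lam x' a (w t) j) := by
    intro S hS hnot t ht j hj
    have htT : t ∈ Ioo 0 T := ⟨ht.1, ht.2.trans_le hS⟩
    rw [additiveTerm_congr hrow.1 (x := x) (fun k hk => ?_) hj]
    · exact hrate t htT j hj
    · refine ⟨(hge t (Ioo_subset_Icc_self htT) k).trans_lt, fun hxk => ?_⟩
      by_contra hcon
      exact hnot t ⟨ht.1.le, ht.2⟩
        ((hZmem t).2 ⟨k, ⟨hk, hxk⟩, Ioo_subset_Icc_self htT, not_lt.1 hcon⟩)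
  by_cases hev : ∃ S ∈ Z, S < T ∧ ∀ t ∈ Z, S ≤ t
  · obtain ⟨S, hSZ, hST, hSmin⟩ := hev
    have hSI := hZsub hSZ
    obtain ⟨k, hk, _, hkS⟩ := (hZmem S).1 hSZ
    have hS0 : 0 < S := hSI.1.lt_of_ne fun h => by
      rw [← h, hw0] at hkS
      exact absurd hk.2 (not_lt.2 hkS)
    have hsub : Icc 0 S ⊆ Icc 0 T := Icc_subset_Icc_right hST.le
    have hcard : Set.ncard {k | 0 < a k ∧ w S k < x' k} < N := by
      rw [← hN]
      refine Set.ncard_lt_ncard ⟨fun i hi => ⟨hi.1, (hge S hSI i).trans_lt hi.2⟩, fun hsup => ?_⟩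
      exact absurd (hsup hk).2 (not_lt.2 hkS)
    obtain ⟨z, T', u, hu⟩ := ih _ hcard (fun j => (hx j).trans (hge S hSI j))
      (hlt S ⟨hSI.1, hST⟩) rfl
    exact ⟨z, _, _, hu.concat hS0 hw0 rfl (hc.mono hsub) (hm.mono hsub)
      (fun t ht => hlt t ⟨ht.1, ht.2.trans_lt hST⟩) (fun t ht => hin t (hsub ht))
      (hrate' S hST.le fun t ht htZ => absurd (hSmin t htZ) (not_le.2 ht.2))⟩
  · have hnot : ∀ t ∈ Ico 0 T, t ∉ Z := by
      intro t ht htZ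
      obtain ⟨S, hS, hSmin⟩ := (isCompact_Icc.of_isClosed_subset hZcl hZsub).exists_isLeast ⟨t, htZ⟩
      exact hev ⟨S, hS, (hSmin htZ).trans_lt ht.2, fun s hs => hSmin hs⟩
    exact ⟨w T, T, w, hT.le, hw0, rfl, hc, hm, hlt, hwT.ge, hin, ∅, finite_empty,
      fun t ht => hrate' T le_rfl hnot t ht.1⟩

/-- Every round of the algorithm can be carried out. -/
theorem exists_isRound (hd : 1 ≤ d) (hl0 : 0 ≤ lam) (hl1 : lam ≤ 1) (hx' : ∀ j, 0 ≤ x' j)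
    (hrow : IsCoveringRow a) (hx : ∀ j, 0 ≤ x j) : ∃ z, IsRound P d lam x' a x z := by
  by_cases hax : 1 ≤ a ⬝ᵥ x
  · exact ⟨x, Or.inl ⟨hax, rfl⟩⟩
  have hax := not_le.1 hax
  by_cases hf : ∃ j, 0 < a j ∧ P.IsFree j
  · obtain ⟨j, hj, hjf⟩ := hf
    have hinc : 0 ≤ (1 - a ⬝ᵥ x) / a j := div_nonneg (by linarith) hj.le
    refine ⟨x + Pi.single j ((1 - a ⬝ᵥ x) / a j), Or.inr (Or.inl ⟨hax, ⟨j, hj, hjf⟩, fun k => ?_,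
      fun k hk => ?_, ?_⟩)⟩
    · have : 0 ≤ (Pi.single j ((1 - a ⬝ᵥ x) / a j) : Fin n → ℝ) k :=
        (Pi.single_nonneg.2 hinc : (0 : Fin n → ℝ) ≤ _) k
      simpa using this
    · have hne : k ≠ j := fun h => hk (h ▸ ⟨hj, hjf⟩)
      simp [hne]
    · rw [dotProduct_add, dotProduct_single, mul_div_cancel₀ _ hj.ne', add_sub_cancel]
  · push Not at hf
    obtain ⟨z, T, u, h⟩ := exists_isLoop hd hl0 hl1 hx' hrow hf hx hax
    exact ⟨z, Or.inr (Or.inr ⟨hax, hf, T, u, h⟩)⟩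

/-- The algorithm can be carried out as an online algorithm. -/
theorem exists_implements (P : LqObjective n r) (hd : 1 ≤ d) (hl0 : 0 ≤ lam) (hl1 : lam ≤ 1)
    (hx' : ∀ j, 0 ≤ x' j) :
    ∃ alg : OnlineCoveringAlgorithm n, Implements alg P d lam x' := by
  -- The implication makes the step total, with a junk value on inadmissible inputs, so that it can
  -- be chosen as a function and folded over the list of rows.
  have hstep : ∀ x a : Fin n → ℝ, ∃ z : Fin n → ℝ,
      (∀ j, 0 ≤ x j) → IsCoveringRow a → IsRound P d lam x' a x z := by
    intro x a
    by_cases h : (∀ j, 0 ≤ x j) ∧ IsCoveringRow a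
    · obtain ⟨z, hz⟩ := exists_isRound (P := P) hd hl0 hl1 hx' h.2 h.1
      exact ⟨z, fun _ _ => hz⟩
    · exact ⟨0, fun h1 h2 => absurd ⟨h1, h2⟩ h⟩
  choose step hstep using hstep
  have happ : ∀ (l : List (Fin n → ℝ)) (a : Fin n → ℝ),
      (l ++ [a]).foldl step (fun _ => 0) = step (l.foldl step fun _ => 0) a := fun l a => by
    rw [List.foldl_append]; rfl
  have hnn : ∀ l : List (Fin n → ℝ), (∀ b ∈ l, IsCoveringRow b) →
      ∀ j, 0 ≤ l.foldl step (fun _ => 0) j := by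
    intro l
    induction l using List.reverseRecOn with
    | nil => exact fun _ _ => le_rfl
    | append_singleton l a ih =>
      intro hl j
      have h0 := ih fun b hb => hl b (by simp [hb])
      rw [happ]
      exact (h0 j).trans ((hstep _ a h0 (hl a (by simp))).le j)
  refine ⟨⟨fun l => l.foldl step fun _ => 0, fun _ => le_rfl, fun l hl a ha j => ?_,
    fun l hl a ha => ?_⟩, fun _ => rfl, fun l hl a ha => ?_⟩
  · rw [happ]
    exact (hstep _ a (hnn l hl) ha).le j
  · rw [happ]
    exact (hstep _ a (hnn l hl) ha).covers
  · simp only [happ]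
    exact hstep _ a (hnn l hl) ha

end LqCover

theorem theorem6 :
    ∃ C : ℝ, 0 < C ∧
      ∀ (n r : ℕ) (P : LqObjective n r) (d : ℕ) (lam : ℝ) (x' : Fin n → ℝ),
        1 ≤ d → 0 ≤ lam → lam ≤ 1 → (∀ j, 0 ≤ x' j) →
        (∃ alg : OnlineCoveringAlgorithm n, LqCover.Implements alg P d lam x') ∧
        ∀ alg : OnlineCoveringAlgorithm n, LqCover.Implements alg P d lam x' →
          ∀ (m : ℕ) (A : Matrix (Fin m) (Fin n) ℝ),
            (∀ i, IsCoveringRow (A i)) → P.dim A = d →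
            (lam < 1 →
              P.val (alg.output (List.ofFn A)) ≤
                C * (1 / (1 - lam)) * P.val x' +
                  C * (1 + Real.log (condNumber A * d)) * P.opt A) ∧
            (0 < lam →
              P.val (alg.output (List.ofFn A)) ≤
                C * (1 + Real.log (condNumber A * d / lam)) * P.opt A) ∧
            (lam < 1 → (∀ i, 1 ≤ (A *ᵥ x') i) →
              P.val (alg.output (List.ofFn A)) ≤ C * (1 / (1 - lam)) * P.val x') := by
  -- `6 = 2 · 3`: the growth rate of the objective times the constant of `log_add_log_le`.
  refine ⟨6, by norm_num, fun n r P d lam x' hd hl0 hl1 hx' =>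
    ⟨LqCover.exists_implements P hd hl0 hl1 hx', fun alg h m A hA hdim => ?_⟩⟩
  exact h.competitive hd hl0 hl1 hx' A hA hdim
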